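/- For a finite simple graph $G$ let $L(G)=D(G)-A(G)$ be its Laplacian matrix; its second smallest eigenvalue (counted with multiplicity) is the algebraic connectivity $\alpha(G)$, and an eigenvector of $L(G)$ for $\alpha(G)$ is called a Fiedler vector. A pendant vertex is a vertex of degree $1$. A caterpillar is a tree in which the removal of all pendant vertices gives a (possibly empty) path. For a vector $f$ on the vertices, a characteristic vertex is a vertex $v$ with $f(v)=0$ that has a neighbour $u$ with $f(u)\neq 0$, and a characteristic edge is an edge $uw$ with $f(u)>0>f(w)$. **Theorem.** Let $\pi=(d_0,\dots,d_{n-1})$ with $n\ge 2$, and let $T$ be a tree with degree sequence $\pi$ such that $\alpha(T)\le\alpha(T')$ for every tree $T'$ with degree sequence $\pi$. Then $T$ is a caterpillar. Moreover, let $f$ be any Fiedler vector of $T$. Then $f$ has a characteristic vertex or a characteristic edge, and if $n\ge 3$ (so that $T$ has non-pendant vertices), the following holds. Let $P^+$ and $P^-$ be the subgraphs of $T$ induced by the non-pendant vertices $x$ with $f(x)\ge 0$ and with $f(x)\le 0$, respectively. * If $v$ is a characteristic vertex of $f$, then $P^+$ and $P^-$ are non-empty paths that both start at $v$, and the degrees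 (in $T$) of their vertices are non-decreasing along each of them, starting from $v$. * If $uw$ is a characteristic edge of $f$ with $f(u)>0>f(w)$, then $P^+$ is a path that starts at $u$, $P^-$ is a path that starts at $w$, and the degrees (in $T$) of their vertices are non-decreasing along each of them, starting from $u$ and from $w$, respectively. -/

import Mathlib

namespace SimpleGraph

open Classical in
/-- The algebraic connectivity of a finite graph on at least two vertices: the second smallest
eigenvalue, counted with multiplicity, of its Laplacian matrix `D - A`. Mathlib's `eigenvalues₀`
lists the eigenvalues in decreasing order, so the second smallest of `n` has index `n - 2`.
(On fewer than two vertices there is no second eigenvalue, and the value is `0`.) -/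
noncomputable def algebraicConnectivity {V : Type*} [Fintype V] (G : SimpleGraph V) : ℝ :=
  if h : 2 ≤ Fintype.card V then
    (G.isHermitian_lapMatrix ℝ).eigenvalues₀ ⟨Fintype.card V - 2, by omega⟩
  else 0

open Classical in
/-- A Fiedler vector: an eigenvector of the Laplacian matrix for the second smallest eigenvalue. -/
def IsFiedlerVector {V : Type*} [Fintype V] (G : SimpleGraph V) (f : V → ℝ) : Prop :=
  f ≠ 0 ∧ (G.lapMatrix ℝ).mulVec f = G.algebraicConnectivity • f

open Classical in
/-- `d 0, …, d (n - 1)` are, in some order, the degrees of the vertices of `G`. -/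
def HasDegreeSequence {V : Type*} [Fintype V] (G : SimpleGraph V) {n : ℕ} (d : Fin n → ℕ) : Prop :=
  ∃ σ : Fin n ≃ V, ∀ i, G.degree (σ i) = d i

open Classical in
/-- `G` is a tree with degree sequence `d` and has minimal algebraic connectivity among all trees
with degree sequence `d`. (The competing trees may be taken on the same vertex set, as they have
the same number of vertices.) -/
def IsMinimalTree {V : Type*} [Fintype V] (G : SimpleGraph V) {n : ℕ} (d : Fin n → ℕ) : Prop :=
  G.IsTree ∧ G.HasDegreeSequence d ∧
    ∀ H : SimpleGraph V, H.IsTree → H.HasDegreeSequence d →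
      G.algebraicConnectivity ≤ H.algebraicConnectivity

open Classical in
/-- The vertices that are not pendant, i.e. whose degree is not `1`. -/
def nonPendant {V : Type*} [Fintype V] (G : SimpleGraph V) : Set V :=
  {v | G.degree v ≠ 1}

/-- A caterpillar: a tree in which the removal of all pendant vertices gives a path (the path
without vertices is allowed, for the tree with one edge). -/
def IsCaterpillar {V : Type*} [Fintype V] (G : SimpleGraph V) : Prop :=
  G.IsTree ∧ ∃ k : ℕ, Nonempty (pathGraph k ≃g G.induce G.nonPendant)

/-- A characteristic vertex of `f`: a vertex where `f` vanishes and that has a neighbour where `f`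
does not vanish. -/
def IsCharacteristicVertex {V : Type*} (G : SimpleGraph V) (f : V → ℝ) (v : V) : Prop :=
  f v = 0 ∧ ∃ u, G.Adj v u ∧ f u ≠ 0

/-- A characteristic edge of `f`: an edge `uw` with `f u > 0 > f w`; the positive end is named
first. -/
def IsCharacteristicEdge {V : Type*} (G : SimpleGraph V) (f : V → ℝ) (u w : V) : Prop :=
  G.Adj u w ∧ 0 < f u ∧ f w < 0

open Classical in
/-- The vertices in `S` induce a path in `G` (with at least one vertex) that starts at `v`, and the
degrees in `G` of the vertices are non-decreasing along this path, starting from `v`. -/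
def InducesDegreeMonotonePathFrom {V : Type*} [Fintype V] (G : SimpleGraph V) (S : Set V) (v : V) :
    Prop :=
  ∃ (k : ℕ) (e : pathGraph (k + 1) ≃g G.induce S),
    (e 0 : V) = v ∧ Monotone fun i => G.degree (e i : V)

end SimpleGraph

/-!
Let `f` be a Fiedler vector of a minimal tree `T`, with eigenvalue `α`. Everything rests on a
variational bound (`two_function_bound`): if `g₁, g₂ ≥ 0` have disjoint supports and the energy of
each is at most `μ` times its squared norm minus the interaction `-⟨g₁, L g₂⟩`, then the algebraic
connectivity is at most `μ`, because some combination `a g₁ - b g₂` with `a, b > 0` is orthogonal to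
the constants; and if it equals `μ`, then `a g₁ - b g₂` is an eigenvector. The positive and negative
parts of `f` satisfy these inequalities with equality.

The bound is used twice. Applied to `T` itself, it gives the nodal domain theorem for trees
(`pos_on_branch`): seen from a characteristic vertex or from an end of a characteristic edge, each
branch of the tree is positive, negative or zero throughout. Summing the eigenvalue equation over a
branch shows that `f` increases strictly along the positive branches, away from the root.

Applied to a modified tree, it gives the exchange argument (`IsMinimalTree.degree_le_degree`). If
`0 ≤ f p < f q` and `deg p > deg q`, move `deg p - deg q` non-negative branches from `p` to `q` and
raise the values on them by `f q - f p`: no difference along an edge changes, the degrees of `p` and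
`q` are interchanged, and the norm of the positive part grows. The algebraic connectivity would
drop, so there cannot be that many branches to move.

With `q` a maximum `l` of `f`, which is pendant, this says that each non-pendant vertex in the
non-negative part lies between the root and `l`. So the non-pendant vertices are the inner vertices
of the path from a minimum to a maximum of `f`, and `T` is a caterpillar. With `p` and `q`
consecutive on this path, on the non-negative side, the argument shows that the degrees do not decrease. The
non-positive side is the same statement for `-f`.
-/

namespace SimpleGraph

/-! ### The Laplacian form and the Rayleigh principle -/

section Spectral
open Classical
open Matrix Finset
variable {V : Type*} [Fintype V] {G : SimpleGraph V}

/-- The bilinear form `⟨x, L y⟩` of the Laplacian `L` of `G`, as a sum over the edges. -/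
noncomputable def lapForm (G : SimpleGraph V) (x y : V → ℝ) : ℝ :=
  (∑ i, ∑ j, if G.Adj i j then (x i - x j) * (y i - y j) else 0) / 2

lemma lapMatrix_mulVec_eq_sum_ite (G : SimpleGraph V) (y : V → ℝ) (i : V) :
    (G.lapMatrix ℝ *ᵥ y) i = ∑ j, if G.Adj i j then y i - y j else 0 := by
  rw [lapMatrix_mulVec_apply, degree_eq_sum_if_adj, neighborFinset_eq_filter, sum_filter, sum_mul,
    ← sum_sub_distrib]
  exact sum_congr rfl fun j _ => by split_ifs <;> ring

lemma sum_mul_lapMatrix_mulVec (G : SimpleGraph V) (x y : V → ℝ) :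
    ∑ i, x i * (G.lapMatrix ℝ *ᵥ y) i = lapForm G x y := by
  have h1 : ∑ i, x i * (G.lapMatrix ℝ *ᵥ y) i
      = ∑ i, ∑ j, if G.Adj i j then x i * (y i - y j) else 0 := by
    simp only [lapMatrix_mulVec_eq_sum_ite, mul_sum, mul_ite, mul_zero]
  have h2 : ∑ i, x i * (G.lapMatrix ℝ *ᵥ y) i
      = ∑ i, ∑ j, if G.Adj i j then x j * (y j - y i) else 0 := by
    rw [h1, sum_comm]; simp only [G.adj_comm]
  have h3 : lapForm G x y * 2 = (∑ i, ∑ j, if G.Adj i j then x i * (y i - y j) else 0)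
      + ∑ i, ∑ j, if G.Adj i j then x j * (y j - y i) else 0 := by
    rw [lapForm, div_mul_cancel₀ _ two_ne_zero, ← sum_add_distrib]
    refine sum_congr rfl fun i _ => ?_
    rw [← sum_add_distrib]
    exact sum_congr rfl fun j _ => by split_ifs <;> ring
  rw [← h1, ← h2] at h3
  linarith

lemma lapForm_comm (G : SimpleGraph V) (x y : V → ℝ) : lapForm G x y = lapForm G y x := by
  simp only [lapForm, mul_comm]

lemma lapForm_add_right (G : SimpleGraph V) (x y z : V → ℝ) :
    lapForm G x (y + z) = lapForm G x y + lapForm G x z := by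
  simp only [← sum_mul_lapMatrix_mulVec, mulVec_add, Pi.add_apply, mul_add, sum_add_distrib]

lemma lapForm_smul_right (G : SimpleGraph V) (a : ℝ) (x y : V → ℝ) :
    lapForm G x (a • y) = a * lapForm G x y := by
  simp only [← sum_mul_lapMatrix_mulVec, mulVec_smul, Pi.smul_apply, smul_eq_mul, mul_sum]
  exact sum_congr rfl fun _ _ => by ring

lemma lapForm_sub_right (G : SimpleGraph V) (x y z : V → ℝ) :
    lapForm G x (y - z) = lapForm G x y - lapForm G x z := by
  simp only [← sum_mul_lapMatrix_mulVec, mulVec_sub, Pi.sub_apply, mul_sub, sum_sub_distrib]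

lemma lapForm_sub_left (G : SimpleGraph V) (x y z : V → ℝ) :
    lapForm G (x - y) z = lapForm G x z - lapForm G y z := by
  rw [lapForm_comm, lapForm_sub_right, lapForm_comm G z x, lapForm_comm G z y]

lemma lapForm_smul_left (G : SimpleGraph V) (a : ℝ) (x y : V → ℝ) :
    lapForm G (a • x) y = a * lapForm G x y := by
  rw [lapForm_comm, lapForm_smul_right, lapForm_comm]

lemma lapForm_self_nonneg (G : SimpleGraph V) (x : V → ℝ) : 0 ≤ lapForm G x x := by
  refine div_nonneg (sum_nonneg fun i _ => sum_nonneg fun j _ => ?_) two_pos.le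
  split_ifs
  · exact mul_self_nonneg _
  · exact le_rfl

/-- For functions with disjoint supports only the edges between the supports contribute. -/
lemma lapForm_eq_neg_sum (G : SimpleGraph V) (x y : V → ℝ) (h : ∀ i, x i * y i = 0) :
    lapForm G x y = -∑ i, ∑ j, if G.Adj i j then x i * y j else 0 := by
  rw [← sum_mul_lapMatrix_mulVec, ← sum_neg_distrib]
  refine sum_congr rfl fun i _ => ?_
  rw [lapMatrix_mulVec_eq_sum_ite, mul_sum, ← sum_neg_distrib]
  refine sum_congr rfl fun j _ => ?_
  split_ifs
  · rw [mul_sub, h]; ring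
  · simp

/-- The eigenvalue equation at the vertices, tested against an arbitrary function. -/
lemma lapForm_of_eigen {f : V → ℝ} {μ : ℝ} (hf : G.lapMatrix ℝ *ᵥ f = μ • f) (x : V → ℝ) :
    lapForm G x f = μ * ∑ i, x i * f i := by
  rw [← sum_mul_lapMatrix_mulVec, hf, mul_sum]
  exact sum_congr rfl fun i _ => by simp; ring

lemma exists_eigenbasis (G : SimpleGraph V) :
    ∃ b : OrthonormalBasis (Fin (Fintype.card V)) ℝ (EuclideanSpace ℝ V), ∀ i,
      G.lapMatrix ℝ *ᵥ ⇑(b i) = (G.isHermitian_lapMatrix ℝ).eigenvalues₀ i • ⇑(b i) := by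
  let e : Fin (Fintype.card V) ≃ V := Fintype.equivOfCardEq (Fintype.card_fin _)
  refine ⟨(G.isHermitian_lapMatrix ℝ).eigenvectorBasis.reindex e.symm, fun i => ?_⟩
  have := (G.isHermitian_lapMatrix ℝ).mulVec_eigenvectorBasis (e i)
  simpa [IsHermitian.eigenvalues, e] using this

lemma algebraicConnectivity_eq (G : SimpleGraph V) (h : 2 ≤ Fintype.card V) :
    G.algebraicConnectivity =
      (G.isHermitian_lapMatrix ℝ).eigenvalues₀ ⟨Fintype.card V - 2, by omega⟩ := by
  rw [algebraicConnectivity, dif_pos h]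

lemma exists_isFiedlerVector (G : SimpleGraph V) (h : 2 ≤ Fintype.card V) :
    ∃ f, G.IsFiedlerVector f := by
  obtain ⟨b, hb⟩ := exists_eigenbasis G
  refine ⟨b ⟨Fintype.card V - 2, by omega⟩, ?_, ?_⟩
  · intro h0
    apply b.orthonormal.ne_zero ⟨Fintype.card V - 2, by omega⟩
    ext v; exact congrFun h0 v
  · rw [algebraicConnectivity_eq G h]; exact hb _

lemma eq_of_lapMatrix_mulVec_eq_zero (hG : G.Connected) {x : V → ℝ}
    (hx : G.lapMatrix ℝ *ᵥ x = 0) (i j : V) : x i = x j :=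
  (lapMatrix_mulVec_eq_zero_iff_forall_reachable G).mp hx i j (hG.preconnected i j)

/-- The spectral facts behind the Rayleigh principle: in a connected graph the last
eigenvalue in decreasing order is `0` with constant eigenvector, and the one before it is
positive. -/
lemma exists_eigenbasis_of_connected (hG : G.Connected) (h2 : 2 ≤ Fintype.card V) :
    0 < G.algebraicConnectivity ∧
    ∃ (b : OrthonormalBasis (Fin (Fintype.card V)) ℝ (EuclideanSpace ℝ V))
      (μ : Fin (Fintype.card V) → ℝ) (o : Fin (Fintype.card V)),
      (∀ i, G.lapMatrix ℝ *ᵥ ⇑(b i) = μ i • ⇑(b i)) ∧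
      (∀ i, i ≠ o → G.algebraicConnectivity ≤ μ i) ∧ ∀ v w, b o v = b o w := by
  obtain ⟨b, hb⟩ := exists_eigenbasis G
  set μ := (G.isHermitian_lapMatrix ℝ).eigenvalues₀ with hμ
  have hanti : Antitone μ := (G.isHermitian_lapMatrix ℝ).eigenvalues₀_antitone
  let o : Fin (Fintype.card V) := ⟨Fintype.card V - 1, by omega⟩
  let s : Fin (Fintype.card V) := ⟨Fintype.card V - 2, by omega⟩
  have hso : s ≠ o := by simp [s, o, Fin.ext_iff]; omega
  have hα : G.algebraicConnectivity = μ s := algebraicConnectivity_eq G h2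
  have hinner : ∀ x y : EuclideanSpace ℝ V, inner ℝ x y = ∑ v, x v * y v := fun x y => by
    rw [PiLp.inner_apply]; exact sum_congr rfl fun v _ => by simp [mul_comm]
  have hnn : ∀ i, 0 ≤ μ i := by
    intro i
    have h1 := lapForm_of_eigen (hb i) (b i)
    have h3 : ∑ v, b i v * b i v = 1 := by
      rw [← hinner, real_inner_self_eq_norm_sq, b.orthonormal.1 i]; norm_num
    rw [h3, mul_one] at h1
    exact h1 ▸ lapForm_self_nonneg G _
  have hcst : ∀ i, μ i = 0 → ∀ v w, b i v = b i w := fun i hi v w =>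
    eq_of_lapMatrix_mulVec_eq_zero hG (by rw [hb i, hi, zero_smul]) v w
  -- All coordinates of the constant function `1` along eigenvectors of non-zero eigenvalue vanish.
  have horth : ∀ i, μ i ≠ 0 → ∑ v, b i v = 0 := by
    intro i hi
    have h1 := lapForm_of_eigen (hb i) (fun _ => 1)
    have h3 : lapForm G (fun _ => 1) (b i) = 0 := by simp [lapForm]
    simp only [one_mul, h3] at h1
    exact (mul_eq_zero.mp h1.symm).resolve_left hi
  have ho : μ o = 0 := by
    by_contra hne
    have hpos : ∀ i, μ i ≠ 0 := fun i => by
      have : μ o ≤ μ i := hanti (Fin.le_def.mpr (by simp [o]; omega))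
      have := lt_of_le_of_ne (hnn o) (Ne.symm hne)
      linarith
    let u : EuclideanSpace ℝ V := WithLp.toLp 2 fun _ => 1
    have h1 := b.sum_inner_mul_inner u u
    simp only [hinner, u, mul_one, horth _ (hpos _), mul_zero, sum_const_zero] at h1
    simp at h1
    have h3 : Fintype.card V = 0 := by exact_mod_cast h1.symm
    omega
  have hspos : 0 < μ s := by
    refine lt_of_le_of_ne (hnn s) fun hs => ?_
    have h1 : inner ℝ (b s) (b o) = 0 := b.orthonormal.2 hso
    obtain ⟨v⟩ := hG.nonempty
    have hne : ∀ i, μ i = 0 → b i v ≠ 0 := fun i hi h0 => b.orthonormal.ne_zero i (by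
      ext w; rw [hcst i hi w v, h0]; rfl)
    rw [hinner, sum_congr rfl fun w _ => by rw [hcst s hs.symm w v, hcst o ho w v]] at h1
    simp only [sum_const, card_univ, smul_eq_zero, mul_eq_zero] at h1
    rcases h1 with h1 | h1 | h1
    · omega
    · exact hne s hs.symm h1
    · exact hne o ho h1
  refine ⟨hα ▸ hspos, b, μ, o, hb, fun i hi => ?_, hcst o ho⟩
  rw [hα]
  refine hanti (Fin.le_def.mpr ?_)
  have := i.2
  have : (i : ℕ) ≠ Fintype.card V - 1 := fun h => hi (Fin.ext h)
  simp only [s]; omega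

lemma algebraicConnectivity_pos (hG : G.Connected) (h2 : 2 ≤ Fintype.card V) :
    0 < G.algebraicConnectivity :=
  (exists_eigenbasis_of_connected hG h2).1

/-- The Rayleigh principle for the algebraic connectivity. -/
lemma algebraicConnectivity_mul_le (hG : G.Connected) (h2 : 2 ≤ Fintype.card V) {h : V → ℝ}
    (hs : ∑ v, h v = 0) :
    G.algebraicConnectivity * ∑ v, h v * h v ≤ lapForm G h h ∧
    (lapForm G h h ≤ G.algebraicConnectivity * ∑ v, h v * h v →
      G.lapMatrix ℝ *ᵥ h = G.algebraicConnectivity • h) := by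
  obtain ⟨-, b, μ, o, hb, hμ, ho⟩ := exists_eigenbasis_of_connected hG h2
  set α := G.algebraicConnectivity
  have hinner : ∀ x y : EuclideanSpace ℝ V, inner ℝ x y = ∑ v, x v * y v := fun x y => by
    rw [PiLp.inner_apply]; exact sum_congr rfl fun v _ => by simp [mul_comm]
  let c : Fin (Fintype.card V) → ℝ := fun i => ∑ v, b i v * h v
  have hLc : ∀ i, ∑ v, b i v * (G.lapMatrix ℝ *ᵥ h) v = μ i * c i := fun i => by
    rw [sum_mul_lapMatrix_mulVec, lapForm_comm, lapForm_of_eigen (hb i)]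
    simp only [c, mul_comm]
  have hco : c o = 0 := by
    obtain ⟨v⟩ := hG.nonempty
    simp only [c, ho _ v, ← mul_sum, hs, mul_zero]
  have hN : ∑ v, h v * h v = ∑ i, c i * c i := by
    have := b.sum_inner_mul_inner (WithLp.toLp 2 h) (WithLp.toLp 2 h)
    simp only [hinner] at this
    rw [← this]
    refine sum_congr rfl fun i _ => ?_
    simp only [c, mul_comm]
  have hE : lapForm G h h = ∑ i, μ i * (c i * c i) := by
    have := b.sum_inner_mul_inner (WithLp.toLp 2 h) (WithLp.toLp 2 (G.lapMatrix ℝ *ᵥ h))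
    simp only [hinner] at this
    rw [← sum_mul_lapMatrix_mulVec, ← this]
    refine sum_congr rfl fun i _ => ?_
    rw [hLc]
    simp only [c, mul_comm (h _)]; ring
  have hdiff : lapForm G h h - α * ∑ v, h v * h v = ∑ i, (μ i - α) * (c i * c i) := by
    rw [hE, hN, mul_sum, ← sum_sub_distrib]
    exact sum_congr rfl fun i _ => by ring
  have hterm : ∀ i ∈ univ, 0 ≤ (μ i - α) * (c i * c i) := fun i _ => by
    by_cases hi : i = o
    · simp [hi, hco]
    · exact mul_nonneg (sub_nonneg.mpr (hμ i hi)) (mul_self_nonneg _)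
  refine ⟨by linarith [sum_nonneg hterm], fun hle => ?_⟩
  have hz : ∑ i, (μ i - α) * (c i * c i) = 0 := le_antisymm (by linarith) (sum_nonneg hterm)
  have hz' := (sum_eq_zero_iff_of_nonneg hterm).mp hz
  have : (WithLp.toLp 2 (G.lapMatrix ℝ *ᵥ h) : EuclideanSpace ℝ V) = WithLp.toLp 2 (α • h) := by
    refine b.repr.injective (PiLp.ext fun i => ?_)
    rw [b.repr_apply_apply, b.repr_apply_apply, hinner, hinner]
    simp only [Pi.smul_apply, smul_eq_mul]
    rw [hLc, sum_congr rfl fun v _ => mul_left_comm (b i v) α (h v), ← mul_sum]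
    rcases mul_eq_zero.mp (hz' i (mem_univ i)) with h0 | h0
    · rw [sub_eq_zero.mp h0]
    · rw [show c i = 0 by simpa using h0, show ∑ v, b i v * h v = 0 from by simpa using h0]; simp
  exact congrArg WithLp.ofLp this

lemma sum_eq_zero_of_isFiedlerVector (hG : G.Connected) (h2 : 2 ≤ Fintype.card V) {f : V → ℝ}
    (hf : G.IsFiedlerVector f) : ∑ v, f v = 0 := by
  have h1 := lapForm_of_eigen hf.2 (fun _ => 1)
  have h3 : lapForm G (fun _ => 1) f = 0 := by simp [lapForm]
  simp only [one_mul, h3] at h1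
  exact (mul_eq_zero.mp h1.symm).resolve_left (algebraicConnectivity_pos hG h2).ne'

/-- A bound for the algebraic connectivity by two non-negative functions with disjoint supports:
some combination `a g₁ - b g₂` is orthogonal to the constants, and its energy is at most `μ` times
its squared norm as soon as each `gᵢ` falls short of this by the interaction term
`-⟨g₁, L g₂⟩ ≥ 0`. If `μ` does not exceed the algebraic connectivity, then these bounds are
equalities (the one for `g₁` is stated), and the combination is an eigenvector. -/
lemma two_function_bound (hG : G.Connected) (h2 : 2 ≤ Fintype.card V) {g₁ g₂ : V → ℝ} {μ : ℝ}
    (hp₁ : 0 ≤ g₁) (hp₂ : 0 ≤ g₂) (hn₁ : g₁ ≠ 0) (hn₂ : g₂ ≠ 0) (hdisj : ∀ v, g₁ v * g₂ v = 0)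
    (hE₁ : lapForm G g₁ g₁ ≤ μ * ∑ v, g₁ v * g₁ v + lapForm G g₁ g₂)
    (hE₂ : lapForm G g₂ g₂ ≤ μ * ∑ v, g₂ v * g₂ v + lapForm G g₁ g₂)
    (hμ : μ ≤ G.algebraicConnectivity) :
    lapForm G g₁ g₁ = μ * ∑ v, g₁ v * g₁ v + lapForm G g₁ g₂ ∧
    ∃ a b : ℝ, 0 < a ∧ 0 < b ∧
      G.lapMatrix ℝ *ᵥ (a • g₁ - b • g₂) = G.algebraicConnectivity • (a • g₁ - b • g₂) := by
  have hpos : ∀ g : V → ℝ, 0 ≤ g → g ≠ 0 → 0 < ∑ v, g v := fun g hg hn => by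
    obtain ⟨v, hv⟩ := Function.ne_iff.mp hn
    exact sum_pos' (fun v _ => hg v) ⟨v, mem_univ v, lt_of_le_of_ne (hg v) (Ne.symm hv)⟩
  have hX : lapForm G g₁ g₂ ≤ 0 := by
    rw [lapForm_eq_neg_sum G g₁ g₂ hdisj, neg_nonpos]
    refine sum_nonneg fun i _ => sum_nonneg fun j _ => ?_
    split_ifs
    · exact mul_nonneg (hp₁ i) (hp₂ j)
    · exact le_rfl
  set a := ∑ v, g₂ v
  set b := ∑ v, g₁ v
  have ha : 0 < a := hpos g₂ hp₂ hn₂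
  have hb : 0 < b := hpos g₁ hp₁ hn₁
  set h := a • g₁ - b • g₂ with hh
  have hs : ∑ v, h v = 0 := by
    simp only [hh, Pi.sub_apply, Pi.smul_apply, smul_eq_mul, sum_sub_distrib, ← mul_sum]
    exact sub_eq_zero.mpr (mul_comm a b)
  have hN : ∑ v, h v * h v = a ^ 2 * ∑ v, g₁ v * g₁ v + b ^ 2 * ∑ v, g₂ v * g₂ v := by
    rw [mul_sum, mul_sum, ← sum_add_distrib]
    refine sum_congr rfl fun v _ => ?_
    simp only [hh, Pi.sub_apply, Pi.smul_apply, smul_eq_mul]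
    linear_combination (-2 * a * b) * hdisj v
  have hE : lapForm G h h = a ^ 2 * lapForm G g₁ g₁ + b ^ 2 * lapForm G g₂ g₂
      - 2 * a * b * lapForm G g₁ g₂ := by
    simp only [hh, lapForm_sub_left, lapForm_sub_right, lapForm_smul_left, lapForm_smul_right,
      lapForm_comm G g₂ g₁]
    ring
  have hNpos : 0 ≤ ∑ v, h v * h v := sum_nonneg fun v _ => mul_self_nonneg _
  obtain ⟨hray, heq⟩ := algebraicConnectivity_mul_le hG h2 hs
  have h1 := mul_le_mul_of_nonneg_left hE₁ (sq_nonneg a)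
  have h3 := mul_le_mul_of_nonneg_left hE₂ (sq_nonneg b)
  have h4 := mul_nonneg (sq_nonneg (a - b)) (neg_nonneg.mpr hX)
  have h5 := mul_le_mul_of_nonneg_right hμ hNpos
  have hle : lapForm G h h ≤ μ * ∑ v, h v * h v := by rw [hE, hN]; nlinarith
  refine ⟨le_antisymm hE₁ ?_, a, b, ha, hb, heq (hle.trans h5)⟩
  have h6 : a ^ 2 * (μ * ∑ v, g₁ v * g₁ v + lapForm G g₁ g₂) ≤ a ^ 2 * lapForm G g₁ g₁ := by
    have := hray
    rw [hE] at this
    rw [hN] at this h5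
    nlinarith
  exact le_of_mul_le_mul_left h6 (by positivity)

end Spectral

/-! ### Branches of trees -/

section Branches
variable {V : Type*} {T : SimpleGraph V} {p c x y : V}

/-- The branch at `p` towards its neighbour `c`: the vertices that are still connected to `c` after
the removal of the edge `pc`. In a tree this is the component of `c` in `T - p`. -/
def branch (T : SimpleGraph V) (p c : V) : Set V :=
  {x | (T.deleteEdges {s(p, c)}).Reachable c x}

lemma mem_branch_self (T : SimpleGraph V) (p c : V) : c ∈ T.branch p c := Reachable.refl c

lemma notMem_branch (hT : T.IsAcyclic) (h : T.Adj p c) : p ∉ T.branch p c := fun hp =>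
  isBridge_iff.mp (isAcyclic_iff_forall_adj_isBridge.mp hT h) hp.symm

lemma mem_branch_of_adj (hx : x ∈ T.branch p c) (hxy : T.Adj x y) (hne : s(x, y) ≠ s(p, c)) :
    y ∈ T.branch p c :=
  hx.trans (Adj.reachable (by simpa [deleteEdges_adj] using ⟨hxy, by simpa using hne⟩))

/-- The edge `pc` is the only one that leaves the branch. -/
lemma eq_of_adj_of_notMem_branch (hT : T.IsAcyclic) (h : T.Adj p c) (hx : x ∈ T.branch p c)
    (hy : y ∉ T.branch p c) (hxy : T.Adj x y) : x = c ∧ y = p := by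
  by_contra hne
  refine hy (mem_branch_of_adj hx hxy fun he => ?_)
  rcases Sym2.eq_iff.mp he with ⟨rfl, rfl⟩ | ⟨rfl, rfl⟩
  · exact notMem_branch hT h hx
  · exact hne ⟨rfl, rfl⟩

lemma branch_induction {P : V → Prop} (hc : P c)
    (hs : ∀ x y, x ∈ T.branch p c → y ∈ T.branch p c → T.Adj x y → P x → P y) :
    ∀ x ∈ T.branch p c, P x := by
  rintro x hx
  obtain ⟨w⟩ := id hx
  have key : ∀ {a b : V} (w : (T.deleteEdges {s(p, c)}).Walk a b), a ∈ T.branch p c →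
      P a → P b := by
    intro a b w
    induction w with
    | nil => exact fun _ h => h
    | @cons a a' b hadj w ih =>
      intro ha hPa
      have ha' : a' ∈ T.branch p c := Reachable.trans ha hadj.reachable
      exact ih ha' (hs _ _ ha ha' (deleteEdges_le _ hadj) hPa)
  exact key w (mem_branch_self T p c) hc

lemma mem_branch_of_adj_of_ne (hT : T.IsAcyclic) (h : T.Adj p c) (hx : x ∈ T.branch p c)
    (hxy : T.Adj x y) (hy : y ≠ p) : y ∈ T.branch p c := by
  by_contra hn
  exact hy (eq_of_adj_of_notMem_branch hT h hx hn hxy).2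

lemma branch_subset_of_notMem (hT : T.IsAcyclic) {r d : V} (hd : T.Adj r d)
    (hc : c ∈ T.branch r d) (hr : r ∉ T.branch p c) : T.branch p c ⊆ T.branch r d :=
  branch_induction hc fun _ _ _ hy hxy hx =>
    mem_branch_of_adj_of_ne hT hd hx hxy fun hyr => hr (hyr ▸ hy)

lemma disjoint_branch_symm (hT : T.IsAcyclic) (h : T.Adj p c) (hx : x ∈ T.branch p c) :
    x ∉ T.branch c p := fun hx' => by
  rw [branch, Sym2.eq_swap] at hx'
  exact notMem_branch hT h (Reachable.trans hx (Reachable.symm hx'))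

lemma branch_subset_branch (hT : T.IsAcyclic) {d : V} (h : T.Adj p c) (hd : T.Adj c d)
    (hne : d ≠ p) : T.branch c d ⊆ T.branch p c := by
  refine branch_induction (mem_branch_of_adj_of_ne hT h (mem_branch_self T p c) hd hne) ?_
  intro x y hx _ hxy hxb
  by_contra hn
  have := (eq_of_adj_of_notMem_branch hT h hxb hn hxy).1
  exact notMem_branch hT hd (this ▸ hx)

lemma eq_of_mem_branch (hT : T.IsAcyclic) {d : V} (h : T.Adj p c) (hd : T.Adj p d)
    (hx : x ∈ T.branch p c) (hx' : x ∈ T.branch p d) : c = d := by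
  by_contra hne
  exact disjoint_branch_symm hT h hx (branch_subset_branch hT h.symm hd (Ne.symm hne) hx')

lemma Connected.induction_adj (hT : T.Connected) {P : V → Prop} (r : V) (hr : P r)
    (hs : ∀ x y, T.Adj x y → P x → P y) (x : V) : P x := by
  obtain ⟨w⟩ := hT.preconnected r x
  induction w with
  | nil => exact hr
  | cons h w ih => exact ih (hs _ _ h hr)

lemma exists_mem_branch (hT : T.IsTree) (hx : x ≠ p) : ∃ c, T.Adj p c ∧ x ∈ T.branch p c := by
  have := hT.connected.induction_adj (P := fun x => x = p ∨ ∃ c, T.Adj p c ∧ x ∈ T.branch p c) p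
    (Or.inl rfl) ?_ x
  · exact this.resolve_left hx
  rintro x y hxy (rfl | ⟨c, hc, hxc⟩)
  · exact Or.inr ⟨y, hxy, mem_branch_self T x y⟩
  · by_cases hy : y = p
    · exact Or.inl hy
    · exact Or.inr ⟨c, hc, mem_branch_of_adj_of_ne hT.isAcyclic hc hxc hxy hy⟩

/-- The parent of `x` in the tree rooted at `r`. -/
lemma exists_adj_notMem_branch (hT : T.IsTree) {r : V} (hx : x ≠ r) :
    ∃ p, T.Adj p x ∧ r ∉ T.branch p x := by
  obtain ⟨p, hp, hr⟩ := exists_mem_branch hT (Ne.symm hx)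
  exact ⟨p, hp.symm, disjoint_branch_symm hT.isAcyclic hp hr⟩

/-- A vertex `x ≠ r` hangs on its parent `p` in the tree rooted at `r` by a branch that is contained
in a branch at `r`. -/
lemma exists_adj_branch_subset (hT : T.IsTree) {r x : V} (hx : x ≠ r) :
    ∃ p c, T.Adj p x ∧ r ∉ T.branch p x ∧ T.Adj r c ∧ T.branch p x ⊆ T.branch r c := by
  obtain ⟨p, hp, hr⟩ := exists_adj_notMem_branch hT hx
  obtain ⟨c, hc, hxc⟩ := exists_mem_branch hT hx
  exact ⟨p, c, hp, hr, hc, branch_subset_of_notMem hT.isAcyclic hc hxc hr⟩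

lemma mem_branch_or (hT : T.IsTree) (h : T.Adj p c) (x : V) :
    x ∈ T.branch p c ∨ x ∈ T.branch c p := by
  refine hT.connected.induction_adj (P := fun x => x ∈ T.branch p c ∨ x ∈ T.branch c p) c
    (Or.inl (mem_branch_self T p c)) ?_ x
  rintro x y hxy (hx | hx)
  · by_cases hy : y = p
    · exact Or.inr (hy ▸ mem_branch_self T c p)
    · exact Or.inl (mem_branch_of_adj_of_ne hT.isAcyclic h hx hxy hy)
  · by_cases hy : y = c
    · exact Or.inl (hy ▸ mem_branch_self T p c)
    · exact Or.inr (mem_branch_of_adj_of_ne hT.isAcyclic h.symm hx hxy hy)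

/-- A walk that enters a branch passes through its first vertex and the vertex it hangs on. -/
lemma mem_support_of_mem_branch (hT : T.IsAcyclic) (h : T.Adj p c) {u v : V} (w : T.Walk u v)
    (hu : u ∉ T.branch p c) (hv : v ∈ T.branch p c) : p ∈ w.support ∧ c ∈ w.support := by
  obtain ⟨e, he, h1, h2⟩ := w.exists_boundary_dart (T.branch p c)ᶜ hu (by simpa using hv)
  obtain ⟨h3, h4⟩ := eq_of_adj_of_notMem_branch hT h (not_not.mp h2) h1 e.adj.symm
  exact ⟨h4 ▸ w.dart_fst_mem_support_of_mem_darts he, h3 ▸ w.dart_snd_mem_support_of_mem_darts he⟩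

lemma Walk.IsPath.getVert_ne {u v : V} {w : T.Walk u v} (hw : w.IsPath) {i j : ℕ}
    (hi : i ≤ w.length) (hj : j ≤ w.length) (h : i ≠ j) : w.getVert i ≠ w.getVert j :=
  fun he => h (hw.getVert_injOn hi hj he)

lemma getVert_mem_branch (hT : T.IsAcyclic) {u v : V} {w : T.Walk u v} (hw : w.IsPath) {i j : ℕ}
    (hij : i < j) (hj : j ≤ w.length) :
    w.getVert j ∈ T.branch (w.getVert i) (w.getVert (i + 1)) := by
  induction j, hij using Nat.le_induction with
  | base => exact mem_branch_self _ _ _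
  | succ j hij ih =>
    refine mem_branch_of_adj_of_ne hT (w.adj_getVert_succ (by omega)) (ih (by omega))
      (w.adj_getVert_succ (by omega)) (hw.getVert_ne hj (by omega) (by omega))

lemma getVert_adj_iff (hT : T.IsAcyclic) {u v : V} {w : T.Walk u v} (hw : w.IsPath) {i j : ℕ}
    (hi : i ≤ w.length) (hj : j ≤ w.length) :
    T.Adj (w.getVert i) (w.getVert j) ↔ i + 1 = j ∨ j + 1 = i := by
  have key : ∀ {i j : ℕ}, i < j → j ≤ w.length → T.Adj (w.getVert i) (w.getVert j) → i + 1 = j := by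
    intro i j hij hj hadj
    have h1 : T.Adj (w.getVert i) (w.getVert (i + 1)) := w.adj_getVert_succ (by omega)
    have h2 := eq_of_adj_of_notMem_branch hT h1 (getVert_mem_branch hT hw hij hj)
      (notMem_branch hT h1) hadj.symm
    exact (hw.getVert_injOn (by simpa using hj) (by simp; omega) h2.1).symm
  constructor
  · intro h
    rcases lt_trichotomy i j with hij | rfl | hij
    · exact Or.inl (key hij hj h)
    · exact (h.ne rfl).elim
    · exact Or.inr (key hij hi h.symm)
  · rintro (rfl | rfl)
    · exact w.adj_getVert_succ (by omega)
    · exact (w.adj_getVert_succ (by omega)).symm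

/-- A segment of a path of a tree induces a path. -/
lemma exists_pathGraph_iso_induce (hT : T.IsAcyclic) {u v : V} {w : T.Walk u v} (hw : w.IsPath)
    (a k : ℕ) (hk : a + k ≤ w.length + 1) (S : Set V)
    (hS : ∀ x, x ∈ S ↔ ∃ i, a ≤ i ∧ i < a + k ∧ w.getVert i = x) :
    ∃ e : pathGraph k ≃g T.induce S, ∀ i, (e i : V) = w.getVert (a + i) := by
  let g : Fin k → S := fun i => ⟨w.getVert (a + i), (hS _).mpr ⟨a + i, by omega, by omega, rfl⟩⟩
  have hg : Function.Bijective g := by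
    constructor
    · intro i j hij
      have := hw.getVert_injOn (by simp; omega) (by simp; omega) (congrArg Subtype.val hij)
      exact Fin.ext (by omega)
    · rintro ⟨x, hx⟩
      obtain ⟨i, hai, hi, rfl⟩ := (hS x).mp hx
      exact ⟨⟨i - a, by omega⟩, Subtype.ext (by simp [g, Nat.add_sub_cancel' hai])⟩
  refine ⟨⟨Equiv.ofBijective g hg, ?_⟩, fun i => rfl⟩
  intro i j
  simp only [Equiv.ofBijective_apply, comap_adj, Function.Embedding.subtype_apply, g, pathGraph_adj]
  rw [getVert_adj_iff hT hw (by omega) (by omega)]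
  omega

end Branches

/-! ### Nodal domains of Fiedler vectors -/

section Nodal
open Classical
open Matrix Finset
variable {V : Type*} [Fintype V] {T : SimpleGraph V} {f : V → ℝ}

/-- Summing the eigenvalue equation over a branch leaves only the edge that it hangs on. -/
lemma sub_eq_mul_sum_branch (hT : T.IsAcyclic) {μ : ℝ} (hf : T.lapMatrix ℝ *ᵥ f = μ • f) {p c : V}
    (h : T.Adj p c) : f c - f p = μ * ∑ x with x ∈ T.branch p c, f x := by
  have h1 := lapForm_of_eigen hf (fun x => if x ∈ T.branch p c then 1 else 0)
  simp only [ite_mul, one_mul, zero_mul, ← sum_filter] at h1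
  rw [← h1, lapForm, eq_div_iff two_ne_zero]
  have hterm : ∀ i j, (if T.Adj i j then ((if i ∈ T.branch p c then (1 : ℝ) else 0) -
      if j ∈ T.branch p c then 1 else 0) * (f i - f j) else 0) =
      (if i = c then if j = p then f c - f p else 0 else 0) +
      if i = p then if j = c then f c - f p else 0 else 0 := by
    intro i j
    have hc := mem_branch_self T p c
    have hp := notMem_branch hT h
    have key := fun x y => @eq_of_adj_of_notMem_branch V T p c x y hT h
    have hne := h.ne
    by_cases hadj : T.Adj i j
    · by_cases hi : i ∈ T.branch p c <;> by_cases hj : j ∈ T.branch p c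
      · have h1 : i ≠ p := fun e => hp (e ▸ hi)
        have h2 : j ≠ p := fun e => hp (e ▸ hj)
        simp [hi, hj, h1, h2]
      · obtain ⟨rfl, rfl⟩ := key i j hi hj hadj
        simp [hi, hj, hadj, hne.symm]
      · obtain ⟨rfl, rfl⟩ := key j i hj hi hadj.symm
        simp [hi, hj, hadj, hne]
      · have h1 : i ≠ c := fun e => hi (e ▸ hc)
        have h2 : j ≠ c := fun e => hj (e ▸ hc)
        simp [hi, hj, h1, h2]
    · have h1 : ¬ (i = c ∧ j = p) := by rintro ⟨rfl, rfl⟩; exact hadj h.symm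
      have h2 : ¬ (i = p ∧ j = c) := by rintro ⟨rfl, rfl⟩; exact hadj h
      rw [if_neg hadj, ← ite_and, ← ite_and, if_neg h1, if_neg h2, add_zero]
  simp only [hterm, sum_add_distrib]
  simp
  ring

lemma IsFiedlerVector.neg (hf : T.IsFiedlerVector f) : T.IsFiedlerVector (-f) :=
  ⟨neg_ne_zero.mpr hf.1, by rw [mulVec_neg, hf.2, smul_neg]⟩

/-- At a zero of an eigenvector the values at the neighbours sum to zero. -/
lemma sum_neighborFinset_eq_zero {h : V → ℝ} {μ : ℝ} (hh : T.lapMatrix ℝ *ᵥ h = μ • h) {z : V}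
    (hz : h z = 0) : ∑ u ∈ T.neighborFinset z, h u = 0 := by
  have := congrFun hh z
  rw [lapMatrix_mulVec_apply] at this
  simpa [hz] using this

lemma lapForm_nonneg_of_forall_adj {x y : V → ℝ} (hdisj : ∀ i, x i * y i = 0)
    (h : ∀ i j, T.Adj i j → x i * y j ≤ 0) : 0 ≤ lapForm T x y := by
  rw [lapForm_eq_neg_sum T x y hdisj, neg_nonneg]
  refine sum_nonpos fun i _ => sum_nonpos fun j _ => ?_
  split_ifs with hij
  · exact h i j hij
  · exact le_rfl

lemma lapForm_nonpos_of_forall_adj {x y : V → ℝ} (hdisj : ∀ i, x i * y i = 0)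
    (h : ∀ i j, T.Adj i j → 0 ≤ x i * y j) : lapForm T x y ≤ 0 := by
  rw [lapForm_eq_neg_sum T x y hdisj, neg_nonpos]
  refine sum_nonneg fun i _ => sum_nonneg fun j _ => ?_
  split_ifs with hij
  · exact h i j hij
  · exact le_rfl

/-- The nodal domain theorem for trees: if `f p ≤ 0 ≤ f c` on an edge `pc`, with `f c > 0` or
`f p = 0`, and the Fiedler vector `f` takes a positive value on the branch at `p` towards `c` and a
negative value off it, then `f` is positive on the whole branch. The positive part of `f` on the
branch and the negative part off the branch satisfy `two_function_bound`, hence combine to an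
eigenvector; it is non-negative on the branch, so that a zero there would spread to the entire
branch. -/
lemma pos_on_branch (hT : T.IsTree) (h2 : 2 ≤ Fintype.card V) (hf : T.IsFiedlerVector f) {p c : V}
    (h : T.Adj p c) (hp : f p ≤ 0) (hc : 0 ≤ f c) (hpc : 0 < f c ∨ f p = 0)
    (hpos : ∃ x ∈ T.branch p c, 0 < f x) (hneg : ∃ x ∉ T.branch p c, f x < 0) :
    ∀ x ∈ T.branch p c, 0 < f x := by
  set A := T.branch p c with hA
  have hcross : ∀ x y, x ∈ A → y ∉ A → T.Adj x y → x = c ∧ y = p :=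
    fun x y => eq_of_adj_of_notMem_branch hT.isAcyclic h
  set α := T.algebraicConnectivity
  set f₁ : V → ℝ := fun x => if x ∈ A then max (f x) 0 else 0 with hf₁
  set f₂ : V → ℝ := fun x => if x ∈ A then 0 else max (-f x) 0 with hf₂
  set r : V → ℝ := f - (f₁ - f₂) with hr
  have hrin : ∀ x ∈ A, r x = min (f x) 0 := fun x hx => by
    simp only [hr, hf₁, hf₂, Pi.sub_apply, if_pos hx]
    rcases le_total (f x) 0 with h | h <;> simp [h]
  have hrout : ∀ x ∉ A, r x = max (f x) 0 := fun x hx => by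
    simp only [hr, hf₁, hf₂, Pi.sub_apply, if_neg hx]
    rcases le_total (f x) 0 with h | h <;> simp [h]
  have hp₁ : 0 ≤ f₁ := fun x => by simp only [hf₁]; split_ifs <;> simp
  have hp₂ : 0 ≤ f₂ := fun x => by simp only [hf₂]; split_ifs <;> simp
  have hd : ∀ x, f₁ x * f₂ x = 0 := fun x => by simp only [hf₁, hf₂]; split_ifs <;> simp
  have hd₁ : ∀ x, f₁ x * r x = 0 := fun x => by
    by_cases hx : x ∈ A
    · rw [hrin x hx]; simp only [hf₁, if_pos hx]
      rcases le_total (f x) 0 with h | h <;> simp [h]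
    · simp [hf₁, hx]
  have hd₂ : ∀ x, f₂ x * r x = 0 := fun x => by
    by_cases hx : x ∈ A
    · simp [hf₂, hx]
    · rw [hrout x hx]; simp only [hf₂, if_neg hx]
      rcases le_total (f x) 0 with h | h <;> simp [h]
  have hr₁ : 0 ≤ lapForm T f₁ r := lapForm_nonneg_of_forall_adj hd₁ fun i j hij => by
    by_cases hi : i ∈ A
    · refine mul_nonpos_of_nonneg_of_nonpos (hp₁ i) ?_
      by_cases hj : j ∈ A
      · rw [hrin j hj]; exact min_le_right _ _
      · rw [hrout j hj, (hcross i j hi hj hij).2, max_eq_right hp]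
    · simp [hf₁, hi]
  have hr₂ : lapForm T f₂ r ≤ 0 := lapForm_nonpos_of_forall_adj hd₂ fun i j hij => by
    by_cases hi : i ∈ A
    · simp [hf₂, hi]
    · refine mul_nonneg (hp₂ i) ?_
      by_cases hj : j ∈ A
      · rw [hrin j hj, (hcross j i hj hi hij.symm).1, min_eq_right hc]
      · rw [hrout j hj]; exact le_max_right _ _
  have hfr : f = (f₁ - f₂) + r := by rw [hr]; abel
  have he₁ : lapForm T f₁ f = α * ∑ v, f₁ v * f₁ v := by
    rw [lapForm_of_eigen hf.2]
    congr 1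
    refine sum_congr rfl fun v _ => ?_
    rw [show f v = f₁ v - f₂ v + r v from congrFun hfr v]
    linear_combination hd₁ v - hd v
  have he₂ : lapForm T f₂ f = -(α * ∑ v, f₂ v * f₂ v) := by
    rw [lapForm_of_eigen hf.2, ← mul_neg, ← sum_neg_distrib]
    congr 1
    refine sum_congr rfl fun v _ => ?_
    rw [show f v = f₁ v - f₂ v + r v from congrFun hfr v]
    linear_combination hd₂ v + hd v
  rw [hfr, lapForm_add_right, lapForm_sub_right] at he₁ he₂
  rw [lapForm_comm T f₂ f₁] at he₂
  obtain ⟨-, a, b, ha, hb, hh⟩ := two_function_bound hT.connected h2 hp₁ hp₂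
    (by
      obtain ⟨x, hx, hfx⟩ := hpos
      intro h0
      have := congrFun h0 x
      simp only [hf₁, if_pos hx, Pi.zero_apply] at this
      linarith [le_max_left (f x) 0])
    (by
      obtain ⟨x, hx, hfx⟩ := hneg
      intro h0
      have := congrFun h0 x
      simp only [hf₂, if_neg hx, Pi.zero_apply] at this
      linarith [le_max_left (-f x) 0])
    hd (by linarith) (by linarith) le_rfl
  set g := a • f₁ - b • f₂ with hg
  have hgin : ∀ x ∈ A, g x = a * max (f x) 0 := fun x hx => by simp [hg, hf₁, hf₂, hx]
  have hgnn : ∀ x ∈ A, 0 ≤ g x := fun x hx => by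
    rw [hgin x hx]; exact mul_nonneg ha.le (le_max_right _ _)
  have hgpos : ∀ x ∈ A, 0 < g x → 0 < f x := fun x hx h => by
    rw [hgin x hx] at h
    by_contra hn
    rw [max_eq_right (not_lt.mp hn)] at h
    simp at h
  have hposg : ∀ x ∈ A, 0 < f x → 0 < g x := fun x hx h => by
    rw [hgin x hx, max_eq_left h.le]; exact mul_pos ha h
  -- A zero in the branch has no non-zero neighbour in the branch.
  have hspread : ∀ x ∈ A, g x = 0 → ∀ y ∈ A, T.Adj x y → g y = 0 := by
    intro x hx hgx y hy hxy
    have hnb : ∀ u ∈ T.neighborFinset x, 0 ≤ g u := by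
      intro u hu
      by_cases huA : u ∈ A
      · exact hgnn u huA
      · obtain ⟨rfl, rfl⟩ := hcross x u hx huA (by simpa using hu)
        rcases hpc with hpc | hpc
        · exact absurd hgx (hposg _ hx hpc).ne'
        · simp [hg, hf₁, hf₂, huA, hpc]
    exact (sum_eq_zero_iff_of_nonneg hnb).mp (sum_neighborFinset_eq_zero hh hgx) y
      (by simpa using hxy)
  by_contra! hcon
  obtain ⟨z, hz, hfz⟩ := hcon
  have hgz : g z = 0 := by rw [hgin z hz, max_eq_right hfz, mul_zero]
  have hgc : g c = 0 := by
    by_contra hgc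
    refine branch_induction (T := T) (p := p) (c := c) (P := fun x => g x ≠ 0) hgc ?_ z hz hgz
    exact fun x y hx hy hxy hgx hgy => hgx (hspread y hy hgy x hx hxy.symm)
  obtain ⟨x, hx, hfx⟩ := hpos
  refine (hposg x hx hfx).ne' (branch_induction (T := T) (p := p) (c := c) (P := fun x => g x = 0)
    hgc (fun x y hx hy hxy hgx => hspread x hx hgx y hy hxy) x hx)

end Nodal

/-! ### Moving branches -/

section Shift
open Classical
open Matrix Finset
variable {V : Type*} {T G H : SimpleGraph V} {p q : V} {C : Finset V}

/-- The star with centre `p` and leaves `C`. -/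
def starOn (p : V) (C : Finset V) : SimpleGraph V := fromRel fun x y => x = p ∧ y ∈ C

lemma starOn_adj (hp : p ∉ C) {x y : V} :
    (starOn p C).Adj x y ↔ (x = p ∧ y ∈ C) ∨ (y = p ∧ x ∈ C) := by
  simp only [starOn, fromRel_adj, and_iff_right_iff_imp]
  rintro (⟨rfl, hy⟩ | ⟨rfl, hx⟩) rfl <;> exact hp ‹_›

/-- The indicator of adjacency in `H ⊔ starOn p C` splits if no edge of the star belongs to `H`. -/
lemma ite_sup_starOn_adj (hG : G = H ⊔ starOn p C) (hp : p ∉ C) (hC : ∀ c ∈ C, ¬ H.Adj p c)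
    {R : Type*} [AddCommMonoid R] (t : R) (x y : V) : (if G.Adj x y then t else 0) =
      (if H.Adj x y then t else 0) + (if x = p then if y ∈ C then t else 0 else 0) +
        if y = p then if x ∈ C then t else 0 else 0 := by
  have hadj : G.Adj x y ↔ H.Adj x y ∨ (x = p ∧ y ∈ C) ∨ (y = p ∧ x ∈ C) := by
    rw [hG, sup_adj, starOn_adj hp]
  rw [← ite_and, ← ite_and]
  by_cases h1 : x = p ∧ y ∈ C
  · obtain ⟨rfl, hy⟩ := h1
    simp [hy, hC y hy, hp, hadj]
  by_cases h2 : y = p ∧ x ∈ C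
  · obtain ⟨rfl, hx⟩ := h2
    have : ¬ H.Adj x y := fun h => hC x hx h.symm
    simp [hx, this, hp, hadj]
  simp [h1, h2, hadj]

/-- The graph that arises from `T` by moving the branches at `p` towards the vertices of `C` to `q`:
every edge `pc` with `c ∈ C` is replaced by `qc`. -/
def moveBranches (T : SimpleGraph V) (p q : V) (C : Finset V) : SimpleGraph V :=
  T \ starOn p C ⊔ starOn q C

/-- The union of the branches at `p` towards the vertices of `C`. -/
def branches (T : SimpleGraph V) (p : V) (C : Finset V) : Set V :=
  {x | ∃ c ∈ C, x ∈ T.branch p c}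

lemma center_notMem_of_adj (hC : ∀ c ∈ C, T.Adj p c) : p ∉ C := fun h => (hC p h).ne rfl

lemma sdiff_starOn_sup (hC : ∀ c ∈ C, T.Adj p c) : T \ starOn p C ⊔ starOn p C = T := by
  refine sdiff_sup_cancel fun x y h => ?_
  rcases (starOn_adj (center_notMem_of_adj hC)).mp h with ⟨rfl, hc⟩ | ⟨rfl, hc⟩
  · exact hC _ hc
  · exact (hC _ hc).symm

lemma not_sdiff_starOn_adj (hC : ∀ c ∈ C, T.Adj p c) :
    ∀ c ∈ C, ¬ (T \ starOn p C).Adj p c := fun c hc h => by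
  rw [sdiff_adj, starOn_adj (center_notMem_of_adj hC)] at h
  exact h.2 (Or.inl ⟨rfl, hc⟩)

lemma mem_branches_iff_of_sdiff_adj (hT : T.IsTree) (hC : ∀ c ∈ C, T.Adj p c) {x y : V}
    (h : (T \ starOn p C).Adj x y) :
    x ∈ T.branches p C ↔ y ∈ T.branches p C := by
  have key : ∀ {x y : V}, (T \ starOn p C).Adj x y → x ∈ T.branches p C → y ∈ T.branches p C := by
    rintro x y h ⟨c, hc, hx⟩
    by_contra hn
    rw [sdiff_adj, starOn_adj (center_notMem_of_adj hC)] at h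
    obtain ⟨rfl, rfl⟩ := eq_of_adj_of_notMem_branch hT.isAcyclic (hC c hc) hx
      (fun hy => hn ⟨c, hc, hy⟩) h.1
    exact h.2 (Or.inr ⟨rfl, hc⟩)
  exact ⟨key h, key h.symm⟩

lemma reachable_of_notMem_branches (hT : T.IsTree) (hC : ∀ c ∈ C, T.Adj p c)
    (hq : q ∉ T.branches p C) : (T \ starOn p C).Reachable p q := by
  refine (hT.connected.induction_adj (P := fun x => (T \ starOn p C).Reachable p x ∨
    x ∈ T.branches p C) p (Or.inl (Reachable.refl p)) ?_ q).resolve_right hq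
  intro x y hxy h
  by_cases hs : (starOn p C).Adj x y
  · rcases (starOn_adj (center_notMem_of_adj hC)).mp hs with ⟨rfl, hy⟩ | ⟨rfl, hx⟩
    · exact Or.inr ⟨y, hy, mem_branch_self T _ _⟩
    · exact Or.inl (Reachable.refl _)
  · have hadj : (T \ starOn p C).Adj x y := by rw [sdiff_adj]; exact ⟨hxy, hs⟩
    rcases h with h | h
    · exact Or.inl (h.trans hadj.reachable)
    · exact Or.inr ((mem_branches_iff_of_sdiff_adj hT hC hadj).mp h)

lemma notMem_of_notMem_branches (hq : q ∉ T.branches p C) : q ∉ C :=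
  fun h => hq ⟨q, h, mem_branch_self T p q⟩

lemma not_sdiff_starOn_adj_of_notMem (hT : T.IsTree) (hC : ∀ c ∈ C, T.Adj p c)
    (hq : q ∉ T.branches p C) :
    ∀ c ∈ C, ¬ (T \ starOn p C).Adj q c := fun c hc h =>
  hq ((mem_branches_iff_of_sdiff_adj hT hC h).mpr ⟨c, hc, mem_branch_self T p c⟩)

lemma moveBranches_connected (hT : T.IsTree) (hC : ∀ c ∈ C, T.Adj p c)
    (hq : q ∉ T.branches p C) : (T.moveBranches p q C).Connected := by
  have hle : T \ starOn p C ≤ T.moveBranches p q C := le_sup_left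
  have hqC := notMem_of_notMem_branches hq
  have hpq := (reachable_of_notMem_branches hT hC hq).mono hle
  have hstar : ∀ c ∈ C, (T.moveBranches p q C).Reachable p c := fun c hc =>
    hpq.trans (Adj.reachable (by
      rw [moveBranches, sup_adj]; exact Or.inr ((starOn_adj hqC).mpr (Or.inl ⟨rfl, hc⟩))))
  have hall : ∀ x, (T.moveBranches p q C).Reachable p x := by
    refine hT.connected.induction_adj p (Reachable.refl p) fun x y hxy hx => ?_
    by_cases hs : (starOn p C).Adj x y
    · rcases (starOn_adj (center_notMem_of_adj hC)).mp hs with ⟨rfl, hy⟩ | ⟨rfl, _⟩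
      · exact hstar y hy
      · exact Reachable.refl _
    · have hadj : (T \ starOn p C).Adj x y := by rw [sdiff_adj]; exact ⟨hxy, hs⟩
      exact hx.trans (hle hadj).reachable
  have := hT.connected.nonempty
  exact ⟨fun x y => (hall x).symm.trans (hall y)⟩

variable [Fintype V] {f : V → ℝ}

lemma degree_sup_starOn (hG : G = H ⊔ starOn p C) (hp : p ∉ C) (hC : ∀ c ∈ C, ¬ H.Adj p c)
    (x : V) : G.degree x = H.degree x + (if x = p then #C else 0) + if x ∈ C then 1 else 0 := by
  have h1 := degree_eq_sum_if_adj (R := ℕ) G x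
  have h2 := degree_eq_sum_if_adj (R := ℕ) H x
  simp only [Nat.cast_id] at h1 h2
  rw [h1, h2]
  simp only [ite_sup_starOn_adj hG hp hC, sum_add_distrib]
  congr 1
  · congr 1
    split_ifs <;> simp
  · simp

lemma lapForm_sup_starOn (hG : G = H ⊔ starOn p C) (hp : p ∉ C) (hC : ∀ c ∈ C, ¬ H.Adj p c)
    (x y : V → ℝ) : lapForm G x y = lapForm H x y + ∑ c ∈ C, (x p - x c) * (y p - y c) := by
  have h1 : ∑ i, ∑ j, (if i = p then if j ∈ C then (x i - x j) * (y i - y j) else 0 else 0)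
      = ∑ c ∈ C, (x p - x c) * (y p - y c) := by
    rw [sum_eq_single p (fun i _ hi => by simp [hi]) (by simp)]
    simp
  have h2 : ∑ i, ∑ j, (if j = p then if i ∈ C then (x i - x j) * (y i - y j) else 0 else 0)
      = ∑ c ∈ C, (x p - x c) * (y p - y c) := by
    simp only [sum_ite_eq', mem_univ, if_true, ← sum_filter]
    rw [filter_mem_eq_inter, univ_inter]
    exact sum_congr rfl fun c _ => by ring
  simp only [lapForm, ite_sup_starOn_adj hG hp hC, sum_add_distrib]
  rw [h1, h2]; ring

/-- Adding constants on a union `S` of components does not change the form. -/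
lemma lapForm_add_ite {S : Set V} (hS : ∀ x y, H.Adj x y → (x ∈ S ↔ y ∈ S)) (x y : V → ℝ)
    (a b : ℝ) : lapForm H (fun v => x v + if v ∈ S then a else 0)
      (fun v => y v + if v ∈ S then b else 0) = lapForm H x y := by
  simp only [lapForm]
  congr 1
  refine sum_congr rfl fun i _ => sum_congr rfl fun j _ => ?_
  split_ifs with h1 h2 h3 h3 <;> first | (exfalso; have := hS i j h1; tauto) | ring

/-- If the number of moved branches is the difference of the degrees of `p` and `q`, then these two
degrees are interchanged, and all others persist. -/
lemma moveBranches_degree_swap (hT : T.IsTree) (hC : ∀ c ∈ C, T.Adj p c)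
    (hq : q ∉ T.branches p C) (hpq : p ≠ q)
    (hcard : T.degree p = T.degree q + #C) (x : V) :
    (T.moveBranches p q C).degree (Equiv.swap p q x) = T.degree x := by
  have hpC := center_notMem_of_adj hC
  have hqC := notMem_of_notMem_branches hq
  have h1 := degree_sup_starOn (G := T.moveBranches p q C) rfl hqC
    (not_sdiff_starOn_adj_of_notMem hT hC hq)
  have h2 := degree_sup_starOn (sdiff_starOn_sup hC).symm hpC (not_sdiff_starOn_adj hC)
  rw [h1]
  have h2p := h2 p
  have h2q := h2 q
  have h2x := h2 x
  simp only [hpC, hqC, if_true, if_false, hpq.symm] at h2p h2q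
  by_cases hxp : x = p
  · subst hxp
    rw [Equiv.swap_apply_left]; simp [hqC]; omega
  · by_cases hxq : x = q
    · subst hxq
      rw [Equiv.swap_apply_right]; simp [hpC, hpq]; omega
    · rw [Equiv.swap_apply_of_ne_of_ne hxp hxq]
      simp only [hxp, hxq, if_false] at h2x ⊢
      omega

lemma moveBranches_isTree (hT : T.IsTree) (hC : ∀ c ∈ C, T.Adj p c)
    (hq : q ∉ T.branches p C) (hpq : p ≠ q)
    (hcard : T.degree p = T.degree q + #C) : (T.moveBranches p q C).IsTree := by
  rw [isTree_iff_connected_and_card]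
  refine ⟨moveBranches_connected hT hC hq, ?_⟩
  rw [← (isTree_iff_connected_and_card.mp hT).2]
  have h1 := sum_degrees_eq_twice_card_edges (T.moveBranches p q C)
  have h2 := sum_degrees_eq_twice_card_edges T
  rw [← Equiv.sum_comp (Equiv.swap p q)] at h1
  simp only [moveBranches_degree_swap hT hC hq hpq hcard] at h1
  simp only [edgeFinset_card, ← Nat.card_eq_fintype_card] at h1 h2
  omega

/-- If the values of each function on the moved branches are shifted by the difference of its values
at `q` and `p`, then all differences along edges persist. -/
lemma lapForm_moveBranches (hT : T.IsTree) (hC : ∀ c ∈ C, T.Adj p c)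
    (hq : q ∉ T.branches p C) (x y : V → ℝ) :
    lapForm (T.moveBranches p q C) (fun v => x v + if v ∈ T.branches p C then x q - x p else 0)
      (fun v => y v + if v ∈ T.branches p C then y q - y p else 0) = lapForm T x y := by
  have h1 := lapForm_sup_starOn (G := T.moveBranches p q C) rfl (notMem_of_notMem_branches hq)
    (not_sdiff_starOn_adj_of_notMem hT hC hq)
  have h2 := lapForm_sup_starOn (sdiff_starOn_sup hC).symm (center_notMem_of_adj hC)
    (not_sdiff_starOn_adj hC)
  rw [h1, h2, lapForm_add_ite fun x y => mem_branches_iff_of_sdiff_adj hT hC]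
  congr 1
  refine sum_congr rfl fun c hc => ?_
  have hcS : c ∈ T.branches p C := ⟨c, hc, mem_branch_self T p c⟩
  simp only [hcS, hq, if_true, if_false]
  ring

/-- The exchange argument. Let `0 ≤ f p < f q` in a minimal tree, and let the branches at `p` be
non-negative and not contain `q`, with at most `deg q` exceptions `B`. If `deg q < deg p`, then
`deg p - deg q` of these branches could be moved up to `q`: with the values on them raised by
`f q - f p` the energy does not change, but the norm grows. -/
lemma IsMinimalTree.degree_le_degree {n : ℕ} {d : Fin n → ℕ} (hT : T.IsMinimalTree d)
    (h2 : 2 ≤ Fintype.card V) (hf : T.IsFiedlerVector f) (hp : 0 ≤ f p) (hpq : f p < f q)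
    (B : Finset V) (hB : #B ≤ T.degree q)
    (hgood : ∀ c, T.Adj p c → c ∉ B → q ∉ T.branch p c ∧ ∀ x ∈ T.branch p c, 0 ≤ f x) :
    T.degree p ≤ T.degree q := by
  by_contra! hlt
  obtain ⟨hTt, ⟨σ, hσ⟩, hmin⟩ := hT
  obtain ⟨C, hCs, hCc⟩ : ∃ C ⊆ T.neighborFinset p \ B, #C = T.degree p - T.degree q := by
    refine exists_subset_card_eq ?_
    have := le_card_sdiff B (T.neighborFinset p)
    rw [card_neighborFinset_eq_degree] at this
    omega
  have hC : ∀ c ∈ C, T.Adj p c := fun c hc => by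
    simpa using (mem_sdiff.mp (hCs hc)).1
  have hCgood : ∀ c ∈ C, q ∉ T.branch p c ∧ ∀ x ∈ T.branch p c, 0 ≤ f x := fun c hc =>
    hgood c (hC c hc) (mem_sdiff.mp (hCs hc)).2
  have hq : q ∉ T.branches p C := fun ⟨c, hc, h⟩ => (hCgood c hc).1 h
  have hSnn : ∀ x ∈ T.branches p C, 0 ≤ f x := fun x ⟨c, hc, h⟩ => (hCgood c hc).2 x h
  have hne : p ≠ q := fun h => hpq.ne (congrArg f h)
  have hcard : T.degree p = T.degree q + #C := by omega
  obtain ⟨c₀, hc₀⟩ : C.Nonempty := card_pos.mp (by omega)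
  have htree := moveBranches_isTree hTt hC hq hne hcard
  have hα := hmin (T.moveBranches p q C) htree ⟨σ.trans (Equiv.swap p q), fun i => by
    rw [Equiv.trans_apply, ← hσ i]
    exact moveBranches_degree_swap hTt hC hq hne hcard (σ i)⟩
  have hαpos := algebraicConnectivity_pos hTt.connected h2
  set α := T.algebraicConnectivity
  set x : V → ℝ := fun v => max (f v) 0 with hx
  set y : V → ℝ := fun v => max (-f v) 0 with hy
  set g : V → ℝ := fun v => x v + if v ∈ T.branches p C then x q - x p else 0 with hg
  have hfq : 0 < f q := hp.trans_lt hpq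
  have hδ : x q - x p = f q - f p := by simp only [hx, max_eq_left hp, max_eq_left hfq.le]
  have hyq : y q - y p = 0 := by
    simp only [hy]
    rw [max_eq_right (by linarith), max_eq_right (by linarith), sub_zero]
  have hfxy : f = x - y := by
    ext v
    simp only [hx, hy, Pi.sub_apply]
    rcases le_total (f v) 0 with h | h <;> simp [h]
  have hxy : ∀ v, x v * y v = 0 := fun v => by
    simp only [hx, hy]
    rcases le_total (f v) 0 with h | h <;> simp [h]
  have hx0 : 0 ≤ x := fun v => le_max_right _ _
  have hy0 : 0 ≤ y := fun v => le_max_right _ _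
  have hxg : x ≤ g := fun v => by
    simp only [hg]
    split_ifs <;> linarith
  have hgy : ∀ v, g v * y v = 0 := fun v => by
    by_cases hv : v ∈ T.branches p C
    · have : y v = 0 := max_eq_right (by linarith [hSnn v hv])
      rw [this, mul_zero]
    · simp only [hg, if_neg hv, add_zero, hxy]
  have hform := lapForm_moveBranches hTt hC hq
  have hgg : lapForm (T.moveBranches p q C) g g = lapForm T x x := hform x x
  have hgy' : lapForm (T.moveBranches p q C) g y = lapForm T x y := by
    have := hform x y
    simpa only [hyq, ite_self, add_zero] using this
  have hyy : lapForm (T.moveBranches p q C) y y = lapForm T y y := by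
    have := hform y y
    simpa only [hyq, ite_self, add_zero] using this
  have he₁ : lapForm T x f = α * ∑ v, x v * x v := by
    rw [lapForm_of_eigen hf.2]
    congr 1
    refine sum_congr rfl fun v _ => ?_
    rw [congrFun hfxy v, Pi.sub_apply]
    linear_combination - hxy v
  have he₂ : lapForm T y f = -(α * ∑ v, y v * y v) := by
    rw [lapForm_of_eigen hf.2, ← mul_neg, ← sum_neg_distrib]
    congr 1
    refine sum_congr rfl fun v _ => ?_
    rw [congrFun hfxy v, Pi.sub_apply]
    linear_combination hxy v
  rw [hfxy, lapForm_sub_right] at he₁ he₂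
  rw [lapForm_comm T y x] at he₂
  have hc₀S : c₀ ∈ T.branches p C := ⟨c₀, hc₀, mem_branch_self T p c₀⟩
  have hN : ∑ v, x v * x v < ∑ v, g v * g v := by
    refine sum_lt_sum (fun v _ => mul_self_le_mul_self (hx0 v) (hxg v)) ⟨c₀, mem_univ _, ?_⟩
    refine mul_self_lt_mul_self (hx0 c₀) ?_
    simp only [hg, if_pos hc₀S]
    linarith
  have hαN := mul_lt_mul_of_pos_left hN hαpos
  have := (two_function_bound htree.connected h2 (hx0.trans hxg) hy0 ?_ ?_ hgy (μ := α)
    (by rw [hgg, hgy']; linarith) (by rw [hyy, hgy']; linarith) hα).1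
  · rw [hgg, hgy'] at this
    linarith
  · intro h0
    have h1 := hxg q
    rw [h0] at h1
    simp only [hx, Pi.zero_apply] at h1
    linarith [le_max_left (f q) 0]
  · intro h0
    have hnn : ∀ v ∈ univ, 0 ≤ f v := fun v _ => by
      have := congrFun h0 v
      simp only [hy, Pi.zero_apply] at this
      linarith [le_max_left (-f v) 0]
    have := (sum_eq_zero_iff_of_nonneg hnn).mp (sum_eq_zero_of_isFiedlerVector hTt.connected h2 hf)
    exact hfq.ne' (this q (mem_univ q))

end Shift

/-! ### Characteristic vertices and edges, and the shape of minimal trees -/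

section Structure
open Classical
open Matrix Finset
variable {V : Type*} {T : SimpleGraph V} {f : V → ℝ}

lemma IsCharacteristicVertex.neg {v : V} (hv : T.IsCharacteristicVertex f v) :
    T.IsCharacteristicVertex (-f) v := by
  obtain ⟨h0, u, hu, hfu⟩ := hv
  exact ⟨by simp [h0], u, hu, by simpa using hfu⟩

lemma IsCharacteristicEdge.neg {u w : V} (h : T.IsCharacteristicEdge f u w) :
    T.IsCharacteristicEdge (-f) w u :=
  ⟨h.1.symm, neg_pos.mpr h.2.2, neg_lt_zero.mpr h.2.1⟩

/-- The branches at `r` are definite for `f`: each is positive, negative or zero throughout. -/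
def HasDefiniteBranches (T : SimpleGraph V) (f : V → ℝ) (r : V) : Prop :=
  ∀ c, T.Adj r c → (∀ x ∈ T.branch r c, 0 < f x) ∨ (∀ x ∈ T.branch r c, f x < 0) ∨
    ∀ x ∈ T.branch r c, f x = 0

lemma HasDefiniteBranches.neg {r : V} (hr : T.HasDefiniteBranches f r) :
    T.HasDefiniteBranches (-f) r := fun c hc => by
  have := hr c hc
  simp only [Pi.neg_apply, neg_pos, neg_eq_zero, Left.neg_neg_iff]
  tauto

lemma HasDefiniteBranches.pos {r c x : V} (hr : T.HasDefiniteBranches f r) (hc : T.Adj r c)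
    (hx : x ∈ T.branch r c) (hfx : 0 < f x) : ∀ y ∈ T.branch r c, 0 < f y := by
  rcases hr c hc with h | h | h
  · exact h
  · exact absurd hfx (h x hx).not_gt
  · exact absurd (h x hx) hfx.ne'

lemma HasDefiniteBranches.nonneg {r c x : V} (hr : T.HasDefiniteBranches f r) (hc : T.Adj r c)
    (hx : x ∈ T.branch r c) (hfx : 0 ≤ f x) : ∀ y ∈ T.branch r c, 0 ≤ f y := by
  rcases hr c hc with h | h | h
  · exact fun y hy => (h y hy).le
  · exact absurd hfx (h x hx).not_ge
  · exact fun y hy => (h y hy).ge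

/-- A vertex with definite branches lies on every walk from a negative to a positive vertex. -/
lemma HasDefiniteBranches.mem_support (hT : T.IsTree) {r l m : V} (hr : T.HasDefiniteBranches f r)
    (hl : 0 < f l) (hm : f m < 0) (w : T.Walk m l) : r ∈ w.support := by
  by_cases hlr : l = r
  · exact hlr ▸ w.end_mem_support
  · obtain ⟨c, hc, hlc⟩ := exists_mem_branch hT hlr
    exact (mem_support_of_mem_branch hT.isAcyclic hc w
      (fun h => (hr.pos hc hlc hl m h).not_gt hm) hlc).1

variable [Fintype V]

lemma degree_ne_one_of_adj_of_adj {x a b : V} (ha : T.Adj x a) (hb : T.Adj x b) (hab : a ≠ b) :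
    T.degree x ≠ 1 := fun h => by
  obtain ⟨c, -, hc⟩ := degree_eq_one_iff_existsUnique_adj.mp h
  exact hab ((hc a ha).trans (hc b hb).symm)

lemma eq_of_degree_eq_one {x a b : V} (h : T.degree x = 1) (ha : T.Adj x a) (hb : T.Adj x b) :
    a = b := by
  by_contra hab
  exact degree_ne_one_of_adj_of_adj ha hb hab h

lemma sub_eq_mul_of_degree_eq_one {μ : ℝ} (hf : T.lapMatrix ℝ *ᵥ f = μ • f) {x p : V}
    (h : T.degree x = 1) (hp : T.Adj x p) : f x - f p = μ * f x := by
  have h1 := congrFun hf x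
  have h3 : T.neighborFinset x = {p} := by
    ext y
    simp only [mem_neighborFinset, mem_singleton]
    exact ⟨fun hy => eq_of_degree_eq_one h hy hp, fun hy => hy ▸ hp⟩
  rw [lapMatrix_mulVec_apply, h, h3] at h1
  simpa using h1

lemma lt_of_pos_on_branch (hT : T.IsTree) (h2 : 2 ≤ Fintype.card V) (hf : T.IsFiedlerVector f)
    {p c : V} (h : T.Adj p c) (hpos : ∀ x ∈ T.branch p c, 0 < f x) : f p < f c := by
  have h1 := sub_eq_mul_sum_branch hT.isAcyclic hf.2 h
  have h3 : 0 < ∑ x with x ∈ T.branch p c, f x :=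
    sum_pos (fun x hx => hpos x (by simpa using hx)) ⟨c, by simpa using mem_branch_self T p c⟩
  have := mul_pos (algebraicConnectivity_pos hT.connected h2) h3
  linarith

lemma exists_pos_value (hT : T.IsTree) (h2 : 2 ≤ Fintype.card V) (hf : T.IsFiedlerVector f) :
    ∃ x, 0 < f x := by
  obtain ⟨v, hv⟩ := Function.ne_iff.mp hf.1
  obtain ⟨x, -, hx⟩ := exists_pos_of_sum_zero_of_exists_nonzero f
    (sum_eq_zero_of_isFiedlerVector hT.connected h2 hf) ⟨v, mem_univ v, hv⟩
  exact ⟨x, hx⟩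

lemma exists_neg_value (hT : T.IsTree) (h2 : 2 ≤ Fintype.card V) (hf : T.IsFiedlerVector f) :
    ∃ x, f x < 0 := by
  obtain ⟨x, hx⟩ := exists_pos_value hT h2 hf.neg
  exact ⟨x, neg_pos.mp hx⟩

lemma exists_characteristic (hT : T.IsTree) (h2 : 2 ≤ Fintype.card V) (hf : T.IsFiedlerVector f) :
    (∃ v, T.IsCharacteristicVertex f v) ∨ ∃ u w, T.IsCharacteristicEdge f u w := by
  obtain ⟨x, hx⟩ := exists_pos_value hT h2 hf
  obtain ⟨y, hy⟩ := exists_neg_value hT h2 hf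
  obtain ⟨w⟩ := hT.connected.preconnected y x
  obtain ⟨e, -, h1, h3⟩ := w.exists_boundary_dart {z | f z < 0} hy (not_lt.mpr hx.le)
  rcases (not_lt.mp (show ¬ f e.snd < 0 from h3)).eq_or_lt with h0 | h0
  · exact Or.inl ⟨e.snd, h0.symm, e.fst, e.adj.symm, h1.ne⟩
  · exact Or.inr ⟨e.snd, e.fst, e.adj.symm, h0, h1⟩

lemma IsCharacteristicVertex.exists_pos {v : V} (hf : T.IsFiedlerVector f)
    (hv : T.IsCharacteristicVertex f v) : ∃ a, T.Adj v a ∧ 0 < f a := by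
  obtain ⟨h0, u, hu, hfu⟩ := hv
  obtain ⟨x, hx, hfx⟩ := exists_pos_of_sum_zero_of_exists_nonzero f
    (sum_neighborFinset_eq_zero hf.2 h0) ⟨u, by simpa using hu, hfu⟩
  exact ⟨x, by simpa using hx, hfx⟩

lemma IsCharacteristicVertex.exists_neg {v : V} (hf : T.IsFiedlerVector f)
    (hv : T.IsCharacteristicVertex f v) : ∃ a, T.Adj v a ∧ f a < 0 := by
  obtain ⟨a, ha, hfa⟩ := hv.neg.exists_pos hf.neg
  exact ⟨a, ha, neg_pos.mp hfa⟩

lemma IsCharacteristicVertex.mem_nonPendant {v : V} (hf : T.IsFiedlerVector f)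
    (hv : T.IsCharacteristicVertex f v) : v ∈ T.nonPendant := by
  obtain ⟨a, ha, hfa⟩ := hv.exists_pos hf
  obtain ⟨b, hb, hfb⟩ := hv.exists_neg hf
  exact degree_ne_one_of_adj_of_adj ha hb fun h => by rw [h] at hfa; linarith

lemma IsCharacteristicVertex.pos_on_branch {v c x : V} (hT : T.IsTree) (h2 : 2 ≤ Fintype.card V)
    (hf : T.IsFiedlerVector f) (hv : T.IsCharacteristicVertex f v) (hc : T.Adj v c) (hfc : 0 ≤ f c)
    (hx : x ∈ T.branch v c) (hfx : 0 < f x) : ∀ y ∈ T.branch v c, 0 < f y := by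
  obtain ⟨b, hb, hfb⟩ := hv.exists_neg hf
  refine SimpleGraph.pos_on_branch hT h2 hf hc hv.1.le hfc (Or.inr hv.1) ⟨x, hx, hfx⟩ ⟨b, ?_, hfb⟩
  intro hbc
  have := eq_of_mem_branch hT.isAcyclic hc hb hbc (mem_branch_self T v b)
  rw [this] at hfc
  exact hfb.not_ge hfc

lemma IsCharacteristicVertex.hasDefiniteBranches {v : V} (hT : T.IsTree) (h2 : 2 ≤ Fintype.card V)
    (hf : T.IsFiedlerVector f) (hv : T.IsCharacteristicVertex f v) : T.HasDefiniteBranches f v := by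
  intro c hc
  have hcc := mem_branch_self T v c
  have hneg : ∀ x ∈ T.branch v c, f c ≤ 0 → f x < 0 → ∀ y ∈ T.branch v c, f y < 0 :=
    fun x hx hfc hfx y hy => neg_pos.mp (hv.neg.pos_on_branch hT h2 hf.neg hc
      (neg_nonneg.mpr hfc) hx (neg_pos.mpr hfx) y hy)
  rcases lt_trichotomy (f c) 0 with h | h | h
  · exact Or.inr (Or.inl (hneg c hcc h.le h))
  · refine Or.inr (Or.inr fun x hx => ?_)
    rcases lt_trichotomy (f x) 0 with hx0 | hx0 | hx0
    · exact absurd h (hneg x hx h.le hx0 c hcc).ne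
    · exact hx0
    · exact absurd h (hv.pos_on_branch hT h2 hf hc h.ge hx hx0 c hcc).ne'
  · exact Or.inl (hv.pos_on_branch hT h2 hf hc h.le hcc h)

lemma IsCharacteristicEdge.pos_on_branch {u w : V} (hT : T.IsTree) (h2 : 2 ≤ Fintype.card V)
    (hf : T.IsFiedlerVector f) (h : T.IsCharacteristicEdge f u w) :
    ∀ x ∈ T.branch w u, 0 < f x :=
  SimpleGraph.pos_on_branch hT h2 hf h.1.symm h.2.2.le h.2.1.le (Or.inl h.2.1)
    ⟨u, mem_branch_self T w u, h.2.1⟩ ⟨w, notMem_branch hT.isAcyclic h.1.symm, h.2.2⟩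

lemma IsCharacteristicEdge.neg_on_branch {u w : V} (hT : T.IsTree) (h2 : 2 ≤ Fintype.card V)
    (hf : T.IsFiedlerVector f) (h : T.IsCharacteristicEdge f u w) :
    ∀ x ∈ T.branch u w, f x < 0 :=
  fun x hx => neg_pos.mp (h.neg.pos_on_branch hT h2 hf.neg x hx)

lemma IsCharacteristicEdge.hasDefiniteBranches {u w : V} (hT : T.IsTree)
    (h2 : 2 ≤ Fintype.card V) (hf : T.IsFiedlerVector f) (h : T.IsCharacteristicEdge f u w) :
    T.HasDefiniteBranches f u := by
  intro c hc
  by_cases hcw : c = w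
  · exact Or.inr (Or.inl (hcw ▸ h.neg_on_branch hT h2 hf))
  · exact Or.inl fun x hx => h.pos_on_branch hT h2 hf x
      (branch_subset_branch hT.isAcyclic h.1.symm hc hcw hx)

lemma exists_adj_pos_on_branch (hT : T.IsTree) (h2 : 2 ≤ Fintype.card V)
    (hf : T.IsFiedlerVector f) {x : V} (hx : 0 < f x) :
    ∃ p, T.Adj p x ∧ ∀ y ∈ T.branch p x, 0 < f y := by
  have key : ∀ r, T.HasDefiniteBranches f r → x ≠ r →
      ∃ p, T.Adj p x ∧ ∀ y ∈ T.branch p x, 0 < f y := by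
    intro r hr hxr
    obtain ⟨p, c, hp, -, hc, hsub⟩ := exists_adj_branch_subset hT hxr
    exact ⟨p, hp, fun y hy => hr.pos hc (hsub (mem_branch_self T p x)) hx y (hsub hy)⟩
  rcases exists_characteristic hT h2 hf with ⟨v, hv⟩ | ⟨u, w, h⟩
  · exact key v (hv.hasDefiniteBranches hT h2 hf) fun e => hx.ne' (e ▸ hv.1)
  · by_cases hxu : x = u
    · exact ⟨w, hxu ▸ h.1.symm, hxu ▸ h.pos_on_branch hT h2 hf⟩
    · exact key u (h.hasDefiniteBranches hT h2 hf) hxu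

/-- A Fiedler vector of a tree is maximal at pendant vertices only. -/
lemma degree_eq_one_of_forall_le (hT : T.IsTree) (h2 : 2 ≤ Fintype.card V)
    (hf : T.IsFiedlerVector f) {l : V} (hl : ∀ x, f x ≤ f l) : 0 < f l ∧ T.degree l = 1 := by
  obtain ⟨x, hx⟩ := exists_pos_value hT h2 hf
  have hpos : 0 < f l := hx.trans_le (hl x)
  obtain ⟨p, hp, hb⟩ := exists_adj_pos_on_branch hT h2 hf hpos
  refine ⟨hpos, degree_eq_one_iff_existsUnique_adj.mpr ⟨p, hp.symm, fun c hc => ?_⟩⟩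
  by_contra hcp
  exact (lt_of_pos_on_branch hT h2 hf hc fun y hy =>
    hb y (branch_subset_branch hT.isAcyclic hp hc hcp hy)).not_ge (hl c)

lemma exists_forall_le (hT : T.IsTree) (f : V → ℝ) : ∃ l, ∀ x, f x ≤ f l :=
  have := hT.connected.nonempty
  Finite.exists_max f

/-- In a minimal tree every non-negative branch below a non-pendant vertex `z` contains each
maximum `l` of the Fiedler vector, since otherwise all branches hanging on `z` could be moved to the
pendant vertex `l`. -/
lemma IsMinimalTree.mem_branch_of_forall_le {n : ℕ} {d : Fin n → ℕ} (hT : T.IsMinimalTree d)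
    (h2 : 2 ≤ Fintype.card V) (hf : T.IsFiedlerVector f) {l p z : V} (hl : ∀ x, f x ≤ f l)
    (hp : T.Adj p z) (hz : z ∈ T.nonPendant) (hnn : ∀ x ∈ T.branch p z, 0 ≤ f x) :
    l ∈ T.branch p z := by
  by_contra hn
  have hl1 := (degree_eq_one_of_forall_le hT.1 h2 hf hl).2
  have hlt : f z < f l := by
    refine lt_of_le_of_ne (hl z) fun he => hz ?_
    exact (degree_eq_one_of_forall_le hT.1 h2 hf (l := z) fun x => he ▸ hl x).2
  have h1 := hT.degree_le_degree h2 hf (hnn z (mem_branch_self T p z)) hlt {p} (by simp [hl1])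
    fun c hc hcp => by
      have hsub := branch_subset_branch hT.1.isAcyclic hp hc (by simpa using hcp)
      exact ⟨fun h => hn (hsub h), fun x hx => hnn x (hsub hx)⟩
  have h3 : 0 < T.degree z := (degree_pos_iff_exists_adj T z).mpr ⟨p, hp.symm⟩
  exact hz (by omega : T.degree z = 1)

/-- The non-pendant vertices of a minimal tree are the inner vertices of the path from a minimum to
a maximum of a Fiedler vector. -/
lemma IsMinimalTree.isCaterpillar {n : ℕ} {d : Fin n → ℕ} (hT : T.IsMinimalTree d)
    (h2 : 2 ≤ Fintype.card V) : T.IsCaterpillar := by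
  have hTt := hT.1
  have hA := hTt.isAcyclic
  obtain ⟨f, hf⟩ := exists_isFiedlerVector T h2
  obtain ⟨l, hl⟩ := exists_forall_le hTt f
  obtain ⟨m, hm⟩ := exists_forall_le hTt (-f)
  obtain ⟨hl0, hl1⟩ := degree_eq_one_of_forall_le hTt h2 hf hl
  obtain ⟨hm0, hm1⟩ := degree_eq_one_of_forall_le hTt h2 hf.neg hm
  have hm0' : f m < 0 := neg_pos.mp hm0
  obtain ⟨r, hr⟩ : ∃ r, T.HasDefiniteBranches f r := by
    rcases exists_characteristic hTt h2 hf with ⟨v, hv⟩ | ⟨u, w, h⟩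
    · exact ⟨v, hv.hasDefiniteBranches hTt h2 hf⟩
    · exact ⟨u, h.hasDefiniteBranches hTt h2 hf⟩
  obtain ⟨w, hw, -⟩ := hTt.existsUnique_path m l
  have hmem : ∀ z ∈ T.nonPendant, z ∈ w.support := by
    intro z hz
    by_cases hzr : z = r
    · exact hzr ▸ hr.mem_support hTt hl0 hm0' w
    obtain ⟨p, c, hp, -, hc, hsub⟩ := exists_adj_branch_subset hTt hzr
    have hzc := hsub (mem_branch_self T p z)
    rcases le_total 0 (f z) with h | h
    · have hnn : ∀ x ∈ T.branch p z, 0 ≤ f x := fun x hx => hr.nonneg hc hzc h x (hsub hx)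
      exact (mem_support_of_mem_branch hA hp w (fun h => (hnn m h).not_gt hm0')
        (hT.mem_branch_of_forall_le h2 hf hl hp hz hnn)).2
    · have hnn : ∀ x ∈ T.branch p z, 0 ≤ (-f) x := fun x hx =>
        hr.neg.nonneg hc hzc (neg_nonneg.mpr h) x (hsub hx)
      have := (mem_support_of_mem_branch hA hp w.reverse
        (fun h => (neg_nonneg.mp (hnn l h)).not_gt hl0)
        (hT.mem_branch_of_forall_le h2 hf.neg hm hp hz hnn)).2
      simpa using this
  have hlen : w.length ≠ 0 := fun h0 => by
    have := w.eq_of_length_eq_zero h0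
    rw [this] at hm0'
    exact hm0'.not_gt hl0
  suffices hS : ∀ x, x ∈ T.nonPendant ↔ ∃ i, 1 ≤ i ∧ i < 1 + (w.length - 1) ∧ w.getVert i = x by
    obtain ⟨e, -⟩ := exists_pathGraph_iso_induce hA hw 1 (w.length - 1) (by omega) _ hS
    exact ⟨hTt, w.length - 1, ⟨e⟩⟩
  intro x
  constructor
  · intro hx
    obtain ⟨i, rfl, hi⟩ := Walk.mem_support_iff_exists_getVert.mp (hmem x hx)
    refine ⟨i, ?_, ?_, rfl⟩
    · by_contra h
      obtain rfl : i = 0 := by omega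
      exact hx (by rw [Walk.getVert_zero]; exact hm1)
    · by_contra h
      obtain rfl : i = w.length := by omega
      exact hx (by rw [Walk.getVert_length]; exact hl1)
  · rintro ⟨i, hi, hi', rfl⟩
    obtain ⟨i, rfl⟩ : ∃ j, i = j + 1 := ⟨i - 1, by omega⟩
    exact degree_ne_one_of_adj_of_adj (w.adj_getVert_succ (i := i) (by omega)).symm
      (w.adj_getVert_succ (i := i + 1) (by omega)) (hw.getVert_ne (by omega) (by omega) (by omega))

/-- The non-negative part of the spine of a minimal tree, seen from a non-negative vertex `r` with
definite branches: it is the path from `r` to a maximum `l` of the Fiedler vector, without `l`. If a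
degree dropped along it, then branches could be moved upwards. -/
lemma IsMinimalTree.inducesDegreeMonotonePathFrom {n : ℕ} {d : Fin n → ℕ} (hT : T.IsMinimalTree d)
    (h2 : 2 ≤ Fintype.card V) (hf : T.IsFiedlerVector f) {r : V} (hr : T.HasDefiniteBranches f r)
    (hr0 : 0 ≤ f r) (hrn : r ∈ T.nonPendant)
    (hneg : T.algebraicConnectivity ≠ 1 →
      ∃ b, ∀ c, T.Adj r c → c ≠ b → ∀ x ∈ T.branch r c, 0 ≤ f x) :
    T.InducesDegreeMonotonePathFrom {x | x ∈ T.nonPendant ∧ 0 ≤ f x} r := by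
  have hTt := hT.1
  have hA := hTt.isAcyclic
  obtain ⟨l, hl⟩ := exists_forall_le hTt f
  obtain ⟨hl0, hl1⟩ := degree_eq_one_of_forall_le hTt h2 hf hl
  obtain ⟨w, hw, -⟩ := hTt.existsUnique_path r l
  obtain ⟨k, hk⟩ : ∃ k, w.length = k + 1 := Nat.exists_eq_succ_of_ne_zero fun h0 =>
    hrn ((w.eq_of_length_eq_zero h0).symm ▸ hl1)
  have hadj : ∀ i, i ≤ k → T.Adj (w.getVert i) (w.getVert (i + 1)) := fun i hi =>
    w.adj_getVert_succ (by omega)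
  have hinner : ∀ i, i < k → w.getVert (i + 1) ∈ T.nonPendant := fun i hi =>
    degree_ne_one_of_adj_of_adj (hadj i hi.le).symm (hadj (i + 1) hi)
      (hw.getVert_ne (by omega) (by omega) (by omega))
  have hpos : ∀ i, i ≤ k → ∀ x ∈ T.branch (w.getVert i) (w.getVert (i + 1)), 0 < f x := by
    intro i hi
    induction i with
    | zero =>
      have hlb := getVert_mem_branch hA hw (i := 0) (j := k + 1) (by omega) (by omega)
      have h0 := hadj 0 hi
      rw [← hk, w.getVert_length] at hlb
      rw [w.getVert_zero] at hlb h0 ⊢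
      exact hr.pos h0 hlb hl0
    | succ i ih =>
      intro x hx
      exact ih (by omega) x (branch_subset_branch hA (hadj i (by omega)) (hadj (i + 1) hi)
        (hw.getVert_ne (by omega) (by omega) (by omega)) hx)
  have hS : ∀ x, x ∈ {x | x ∈ T.nonPendant ∧ 0 ≤ f x} ↔
      ∃ i, 0 ≤ i ∧ i < 0 + (k + 1) ∧ w.getVert i = x := by
    intro x
    constructor
    · rintro ⟨hx, hfx⟩
      by_cases hxr : x = r
      · exact ⟨0, le_rfl, by omega, by rw [w.getVert_zero, hxr]⟩
      obtain ⟨p, c, hp, hrp, hc, hsub⟩ := exists_adj_branch_subset hTt hxr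
      have hnn : ∀ y ∈ T.branch p x, 0 ≤ f y := fun y hy =>
        hr.nonneg hc (hsub (mem_branch_self T p x)) hfx y (hsub hy)
      obtain ⟨i, hi, hi'⟩ := Walk.mem_support_iff_exists_getVert.mp
        (mem_support_of_mem_branch hA hp w hrp (hT.mem_branch_of_forall_le h2 hf hl hp hx hnn)).2
      refine ⟨i, Nat.zero_le i, ?_, hi⟩
      by_contra h
      obtain rfl : i = w.length := by omega
      exact hx (by rw [← hi, w.getVert_length]; exact hl1)
    · rintro ⟨i, -, hi, rfl⟩
      rcases i with - | i
      · rw [w.getVert_zero]; exact ⟨hrn, hr0⟩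
      · exact ⟨hinner i (by omega), (hpos i (by omega) _ (mem_branch_self T _ _)).le⟩
  obtain ⟨e, he⟩ := exists_pathGraph_iso_induce hA hw 0 (k + 1) (by omega) _ hS
  suffices hmono : ∀ j < k, T.degree (w.getVert j) ≤ T.degree (w.getVert (j + 1)) by
    refine ⟨k, e, by rw [he]; exact w.getVert_zero, Fin.monotone_iff_le_succ.mpr fun i => ?_⟩
    have he' : ∀ i, (e i : V) = w.getVert i := fun i => (he i).trans (by rw [zero_add])
    rw [he', he']
    exact hmono i i.2
  intro j hik
  have hjj := hadj j hik.le
  have hnn : 0 ≤ f (w.getVert j) := ((hS _).mpr ⟨j, Nat.zero_le j, by omega, rfl⟩).2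
  have hlt := lt_of_pos_on_branch hTt h2 hf hjj (hpos j hik.le)
  have hdeg : 2 ≤ T.degree (w.getVert (j + 1)) := by
    have h1 : 0 < T.degree (w.getVert (j + 1)) :=
      (degree_pos_iff_exists_adj T _).mpr ⟨_, hjj.symm⟩
    have h3 : T.degree (w.getVert (j + 1)) ≠ 1 := hinner j hik
    omega
  -- Apart from the next vertex, there is at most one neighbour whose branch cannot be moved.
  obtain ⟨b, hb⟩ : ∃ b, ∀ c, T.Adj (w.getVert j) c → c ≠ b → c ≠ w.getVert (j + 1) →
      ∀ x ∈ T.branch (w.getVert j) c, 0 ≤ f x := by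
    rcases j with - | j
    -- If the eigenvalue is `1`, then `f` vanishes next to the pendant vertex `l`.
    · obtain ⟨b, hb⟩ := hneg fun hα => by
        have hkl := hadj k le_rfl
        rw [← hk, w.getVert_length] at hkl
        have h1 := sub_eq_mul_of_degree_eq_one hf.2 hl1 hkl.symm
        obtain ⟨k, rfl⟩ : ∃ k', k = k' + 1 := ⟨k - 1, by omega⟩
        have h3 := hpos k (by omega) _ (mem_branch_self T _ _)
        rw [hα] at h1
        linarith
      exact ⟨b, fun c hc hcb _ => by rw [w.getVert_zero] at hc ⊢; exact hb c hc hcb⟩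
    · refine ⟨w.getVert j, fun c hc hcj _ x hx => ?_⟩
      exact (hpos j (by omega) x (branch_subset_branch hA (hadj j (by omega)) hc hcj hx)).le
  refine hT.degree_le_degree h2 hf hnn hlt {w.getVert (j + 1), b} (card_le_two.trans hdeg) ?_
  intro c hc hcB
  simp only [mem_insert, mem_singleton, not_or] at hcB
  refine ⟨fun h => hcB.1 ?_, hb c hc hcB.2 hcB.1⟩
  exact eq_of_mem_branch hA hc hjj h (mem_branch_self T _ _)

/-- At a characteristic vertex only one branch is negative: a negative pendant neighbour would force
the eigenvalue `1`, every other negative branch contains the minima of `f`, and distinct branches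
are disjoint. -/
lemma IsCharacteristicVertex.exists_forall_nonneg {n : ℕ} {d : Fin n → ℕ} (hT : T.IsMinimalTree d)
    (h2 : 2 ≤ Fintype.card V) (hf : T.IsFiedlerVector f) {v : V}
    (hv : T.IsCharacteristicVertex f v) (hα : T.algebraicConnectivity ≠ 1) :
    ∃ b, ∀ c, T.Adj v c → c ≠ b → ∀ x ∈ T.branch v c, 0 ≤ f x := by
  have hr := hv.hasDefiniteBranches hT.1 h2 hf
  obtain ⟨m, hm⟩ := exists_forall_le hT.1 (-f)
  have key : ∀ c, T.Adj v c → f c < 0 → m ∈ T.branch v c := by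
    intro c hc hfc
    refine hT.mem_branch_of_forall_le h2 hf.neg hm hc (fun h1 => hα ?_)
      (hr.neg.nonneg hc (mem_branch_self T v c) (neg_nonneg.mpr hfc.le))
    have h3 := sub_eq_mul_of_degree_eq_one hf.2 h1 hc.symm
    rw [hv.1, sub_zero] at h3
    exact mul_right_cancel₀ hfc.ne (by rw [one_mul, ← h3])
  obtain ⟨b, hb, hfb⟩ := hv.exists_neg hf
  refine ⟨b, fun c hc hcb => hr.nonneg hc (mem_branch_self T v c) ?_⟩
  by_contra! hfc
  exact hcb (eq_of_mem_branch hT.1.isAcyclic hc hb (key c hc hfc) (key b hb hfb))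

/-- The ends of a characteristic edge are not pendant: at a pendant end the eigenvalue equation
makes the eigenvalue exceed `1`, so that the sign changes at every pendant vertex, but there is no
such change at a minimum of `f`, which is pendant. -/
lemma IsCharacteristicEdge.mem_nonPendant {u w : V} (hT : T.IsTree) (h3 : 3 ≤ Fintype.card V)
    (hf : T.IsFiedlerVector f) (h : T.IsCharacteristicEdge f u w) : u ∈ T.nonPendant := by
  intro hu
  have h2 : 2 ≤ Fintype.card V := by omega
  have hA := hT.isAcyclic
  obtain ⟨m, hm⟩ := exists_forall_le hT (-f)
  obtain ⟨hm0, hm1⟩ := degree_eq_one_of_forall_le hT h2 hf.neg hm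
  have hm0' : f m < 0 := neg_pos.mp hm0
  obtain ⟨huw, hfu, hfw⟩ := id h
  have hmw : m ≠ w := by
    rintro rfl
    obtain ⟨x, hx⟩ : ∃ x, x ∉ ({u, m} : Finset V) := by
      by_contra! hall
      have := card_le_card (fun x _ => hall x : univ ⊆ ({u, m} : Finset V))
      rw [card_univ] at this
      have := card_le_two (a := u) (b := m)
      omega
    simp only [mem_insert, mem_singleton, not_or] at hx
    obtain ⟨c, hc, hxc⟩ := exists_mem_branch hT hx.1
    obtain ⟨c', hc', hxc'⟩ := exists_mem_branch hT hx.2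
    rw [eq_of_degree_eq_one hu hc huw] at hxc
    rw [eq_of_degree_eq_one hm1 hc' huw.symm] at hxc'
    exact disjoint_branch_symm hA huw hxc hxc'
  have hmb : m ∈ T.branch u w := (mem_branch_or hT huw m).resolve_right fun hb =>
    hm0'.not_gt (h.pos_on_branch hT h2 hf m hb)
  obtain ⟨p, hp⟩ := (degree_pos_iff_exists_adj T m).mp (by omega)
  have hpb : p ∈ T.branch u w := by
    by_contra hn
    exact hmw (eq_of_adj_of_notMem_branch hA huw hmb hn hp).1
  have hfp := h.neg_on_branch hT h2 hf p hpb
  have e1 := sub_eq_mul_of_degree_eq_one hf.2 hu huw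
  have e2 := sub_eq_mul_of_degree_eq_one hf.2 hm1 hp
  have hα : 1 < T.algebraicConnectivity := by
    by_contra! hle
    nlinarith
  nlinarith

end Structure

end SimpleGraph

theorem theorem1 {V : Type*} [Fintype V] (T : SimpleGraph V)
    (n : ℕ) (hn : 2 ≤ n) (d : Fin n → ℕ) (hT : T.IsMinimalTree d) :
    T.IsCaterpillar ∧
    ∀ f : V → ℝ, T.IsFiedlerVector f →
      ((∃ v, T.IsCharacteristicVertex f v) ∨ (∃ u w, T.IsCharacteristicEdge f u w)) ∧
      (3 ≤ n →
        (∀ v, T.IsCharacteristicVertex f v →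
          T.InducesDegreeMonotonePathFrom {x | x ∈ T.nonPendant ∧ 0 ≤ f x} v ∧
          T.InducesDegreeMonotonePathFrom {x | x ∈ T.nonPendant ∧ f x ≤ 0} v) ∧
        (∀ u w, T.IsCharacteristicEdge f u w →
          T.InducesDegreeMonotonePathFrom {x | x ∈ T.nonPendant ∧ 0 ≤ f x} u ∧
          T.InducesDegreeMonotonePathFrom {x | x ∈ T.nonPendant ∧ f x ≤ 0} w)) := by
  have hcard : Fintype.card V = n := by
    obtain ⟨-, ⟨σ, -⟩, -⟩ := hT
    simpa using (Fintype.card_congr σ).symm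
  have h2 : 2 ≤ Fintype.card V := by omega
  have hTt := hT.1
  refine ⟨hT.isCaterpillar h2, fun f hf => ⟨SimpleGraph.exists_characteristic hTt h2 hf,
    fun h3 => ⟨fun v hv => ?_, fun u w h => ?_⟩⟩⟩
  · have hpart : ∀ g : V → ℝ, T.IsFiedlerVector g → T.IsCharacteristicVertex g v →
        T.InducesDegreeMonotonePathFrom {x | x ∈ T.nonPendant ∧ 0 ≤ g x} v := fun g hg hv =>
      hT.inducesDegreeMonotonePathFrom h2 hg (hv.hasDefiniteBranches hTt h2 hg) hv.1.ge
        (hv.mem_nonPendant hg) (hv.exists_forall_nonneg hT h2 hg)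
    refine ⟨hpart f hf hv, ?_⟩
    simpa only [Pi.neg_apply, neg_nonneg] using hpart (-f) hf.neg hv.neg
  · have hpart : ∀ (g : V → ℝ) (u w : V), T.IsFiedlerVector g → T.IsCharacteristicEdge g u w →
        T.InducesDegreeMonotonePathFrom {x | x ∈ T.nonPendant ∧ 0 ≤ g x} u := fun g u w hg h =>
      hT.inducesDegreeMonotonePathFrom h2 hg (h.hasDefiniteBranches hTt h2 hg) h.2.1.le
        (h.mem_nonPendant hTt (by omega) hg) fun _ => ⟨w, fun c hc hcw x hx =>
          (h.pos_on_branch hTt h2 hg x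
            (SimpleGraph.branch_subset_branch hTt.isAcyclic h.1.symm hc hcw hx)).le⟩
    refine ⟨hpart f u w hf h, ?_⟩
    simpa only [Pi.neg_apply, neg_nonneg] using hpart (-f) w u hf.neg h.neg
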